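/- Let $M$ and $B$ be compact smooth Riemannian manifolds without boundary, of even dimension, and let $\pi : M \to B$ be a smooth surjective map. Write $C^\infty(\cdot)$ for the complex-valued smooth functions and $\mathfrak{X}(\cdot)$ for the complex smooth vector fields, with the hermitian form (conjugate-linear in the first variable) induced by the metric; $C^\infty(M)$ is a $C^\infty(B)$-algebra through $f \mapsto f\circ\pi$. Let $d\pi : \mathfrak{X}(M) \to \mathfrak{X}(B)\otimes_{C^\infty(B)} C^\infty(M)$ be given by $d\pi(X)(f) = X(f\circ\pi)$, and suppose that $\pi$ is a Riemannian submersion: $d\pi$ is surjective and restricts to an isometric isomorphism from $\mathfrak{X}_H(M) := (\ker d\pi)^\perp$ onto $\mathfrak{X}(B)\otimes_{C^\infty(B)} C^\infty(M)$. Put $\mathfrak{X}_V(M) := \ker d\pi$. Let $\mathrm{Cl}(M)$ be the complex Clifford algebra over $C^\infty(M)$ generated by $\mathfrak{X}(M)$ with $XY+YX = 2\langle X,Y\rangle$ and $X^*=X$ for real vector fields $X,Y$, graded by $X\mapsto -X$, and let $\mathrm{Cl}_H(M)$, $\mathrm{Cl}_V(M)$ be the subalgebras generated by $\mathfrak{X}_H(M)$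 and $\mathfrak{X}_V(M)$. Let $\mathscr{E}_M$ be a spinor module over $M$: a finitely generated projective $C^\infty(M)$-module with a positive hermitian form that identifies $\mathscr{E}_M$ with its conjugate dual, a unitary grading operator $\gamma_M$ with $\gamma_M^2 = 1$, and an isomorphism $c : \mathrm{Cl}(M) \to \mathrm{End}_{C^\infty(M)}(\mathscr{E}_M)$ of $\mathbb{Z}/2$-graded $*$-algebras. Let $\mathscr{E}_B$, with grading operator $\gamma_B$ and Clifford action $c_B$, be a spinor module over $B$. Let $\mathscr{E}_H := \mathscr{E}_B \otimes_{C^\infty(B)} C^\infty(M)$ with $\gamma_H := \gamma_B\otimes 1$, with $\langle s\otimes f, t\otimes g\rangle := \overline f\,(\langle s,t\rangle\circ\pi)\, g$, and with the algebra homomorphism $c_H : \mathrm{Cl}_H(M)\to \mathrm{End}(\mathscr{E}_H)$ for which $c_H(X)$, $X\in \mathfrak{X}_H(M)$, is the Clifford multiplication by $d\pi(X)$, where $Y\otimes f$ acts on $\mathscr{E}_H$ as $c_B(Y)\otimes f$. Then $c_H$ is bijective. Let $\mathscr{E}_V := \mathscr{E}_H^*\otimes_{\mathrm{Cl}_H(M)}\mathscr{E}_M$,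 where $x \in \mathrm{Cl}_H(M)$ acts on the dual module $\mathscr{E}_H^*$ from the right by $\varphi\mapsto\varphi\circ c_H(x)$, with $\gamma_V := \gamma_H^*\otimes\gamma_M$ and with the algebra homomorphism $c_V : \mathrm{Cl}_V(M)\to \mathrm{End}(\mathscr{E}_V)$ given by $c_V(X) = \gamma_H^*\otimes c(X)$ for $X \in \mathfrak{X}_V(M)$. There is exactly one sesquilinear form on $\mathscr{E}_V$ with $$\big\langle \langle \xi_1|\otimes s_1, \langle\xi_2|\otimes s_2\big\rangle = \big\langle s_1, c\big(c_H^{-1}(|\xi_1\rangle\langle\xi_2|)\big) s_2\big\rangle \qquad (\xi_1,\xi_2\in\mathscr{E}_H,\ s_1,s_2\in\mathscr{E}_M),$$ where $\langle\xi|$ is the functional $\langle\xi,\cdot\rangle$ and $|\xi_1\rangle\langle\xi_2|$ is the operator $\zeta \mapsto \xi_1\langle\xi_2,\zeta\rangle$ on $\mathscr{E}_H$; this form is conjugate-symmetric. Multiplication $x\mathbin{\widehat\otimes}y\mapsto xy$ is an isomorphism of algebras $\mathrm{Cl}_H(M)\mathbin{\widehat\otimes}_{C^\infty(M)}\mathrm{Cl}_V(M)\cong\mathrm{Cl}(M)$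 (graded tensor product), and $(x\mathbin{\widehat\otimes}y)(\xi\otimes\eta) := c_H(x)\gamma_H^{\deg y}\xi\otimes c_V(y)\eta$, for homogeneous $y$, defines an action of this graded tensor product on $\mathscr{E}_H\otimes_{C^\infty(M)}\mathscr{E}_V$. Finally, there is an isomorphism of $C^\infty(M)$-modules $$\Phi:\mathscr{E}_H\otimes_{C^\infty(M)}\mathscr{E}_V\to\mathscr{E}_M$$ which is isometric for the form $\langle\xi_1\otimes\eta_1,\xi_2\otimes\eta_2\rangle := \langle\eta_1,\eta_2\rangle\langle\xi_1,\xi_2\rangle$, satisfies $\Phi\circ(\gamma_H\otimes\gamma_V) = \gamma_M\circ\Phi$, and satisfies $\Phi(z\cdot e) = c(z)\,\Phi(e)$ for all $z\in\mathrm{Cl}_H(M)\mathbin{\widehat\otimes}\mathrm{Cl}_V(M)\cong\mathrm{Cl}(M)$ and all $e$. -/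

import Mathlib

open scoped TensorProduct Manifold ContDiff ComplexConjugate
set_option linter.unusedSectionVars false
noncomputable section

instance SpinSub.instComplexRing : ContMDiffRing 𝓘(ℝ, ℂ) ∞ ℂ where
  toContMDiffAdd := inferInstance
  contMDiff_mul := by
    rw [contMDiff_iff]
    refine ⟨continuous_mul, fun x y => ?_⟩
    simp only [mfld_simps, chartAt_self_eq]
    rw [contDiffOn_univ]
    exact contDiff_mul

namespace SpinSub

section Algebra
variable {R S : Type*} [CommRing R] [CommRing S] [Algebra R S] [StarRing S]
variable {E P : Type*} [AddCommGroup E] [Module R E] [AddCommGroup P] [Module S P]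

/-- The conjugate-linear map `S ⊗ E → P`, `f ⊗ e ↦ f̄ • K e`, for an additive map `K : E → P` that
is conjugate-linear over `R → S`. -/
def starLift (K : E →+ P) (hK : ∀ (r : R) (e : E), K (r • e) = star (algebraMap R S r) • K e) :
    S ⊗[R] E →ₗ⋆[S] P where
  toFun := TensorProduct.liftAddHom (R := R)
    (AddMonoidHom.mk' (fun f : S => AddMonoidHom.mk' (fun e : E => star f • K e)
      (by intro a b; rw [map_add, smul_add]))
      (by intro a b; ext e; simp [add_smul]))
    (by
      intro r f e
      simp only [AddMonoidHom.mk'_apply, Algebra.smul_def, hK, star_mul, mul_smul])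
  map_add' := map_add _
  map_smul' := by
    intro f t
    induction t with
    | zero => simp
    | add x y hx hy => simp only [smul_add, map_add, hx, hy]
    | tmul g e =>
      simp only [TensorProduct.smul_tmul', TensorProduct.liftAddHom_tmul, AddMonoidHom.mk'_apply,
        smul_eq_mul, star_mul, mul_smul, starRingEnd_apply]
      exact smul_comm _ _ _

@[simp] lemma starLift_tmul (K : E →+ P)
    (hK : ∀ (r : R) (e : E), K (r • e) = star (algebraMap R S r) • K e) (f : S) (e : E) :
    starLift K hK (f ⊗ₜ e) = star f • K e := rfl

/-- A sesquilinear form, conjugate-linear in the first variable. -/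
abbrev SesqForm (R E : Type*) [CommRing R] [StarRing R] [AddCommGroup E] [Module R E] :=
  E →ₗ⋆[R] E →ₗ[R] R

/-- The sesquilinear form `⟨f ⊗ s, g ⊗ t⟩ = f̄ ⟨s, t⟩ g` on `S ⊗ E`. -/
def formBaseChange [StarRing R] (hs : ∀ r : R, algebraMap R S (star r) = star (algebraMap R S r))
    (h : SesqForm R E) : SesqForm S (S ⊗[R] E) :=
  starLift (R := R)
    (AddMonoidHom.mk' (fun s => (Algebra.linearMap R S ∘ₗ h s).liftBaseChange S)
      (by intro a b; ext t; simp))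
    (by
      intro r e; ext t
      simp [← hs, Algebra.smul_def, starRingEnd_apply])

lemma formBaseChange_tmul [StarRing R]
    (hs : ∀ r : R, algebraMap R S (star r) = star (algebraMap R S r))
    (h : SesqForm R E) (f g : S) (s t : E) :
    formBaseChange hs h (f ⊗ₜ s) (g ⊗ₜ t) = star f * (algebraMap R S (h s t) * g) := by
  simp [formBaseChange, mul_comm]

/-- The sesquilinear form `⟨ξ₁ ⊗ η₁, ξ₂ ⊗ η₂⟩ = ⟨η₁, η₂⟩ ⟨ξ₁, ξ₂⟩` on `E ⊗ F`. -/
def formTensor {F : Type*} [AddCommGroup F] [Module S F] {E : Type*} [AddCommGroup E] [Module S E]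
    (h : SesqForm S E) (k : SesqForm S F) : SesqForm S (E ⊗[S] F) :=
  TensorProduct.lift (LinearMap.mk₂'ₛₗ (starRingEnd S) (starRingEnd S)
    (fun ξ η => LinearMap.mul' S S ∘ₗ TensorProduct.map (h ξ) (k η))
    (by intros; ext; simp [add_mul]) (by intros; ext; simp [mul_assoc])
    (by intros; ext; simp [mul_add]) (by intros; ext; simp [mul_left_comm]))

lemma formTensor_tmul {F : Type*} [AddCommGroup F] [Module S F] {E : Type*} [AddCommGroup E]
    [Module S E] (h : SesqForm S E) (k : SesqForm S F) (ξ₁ ξ₂ : E) (η₁ η₂ : F) :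
    formTensor h k (ξ₁ ⊗ₜ η₁) (ξ₂ ⊗ₜ η₂) = k η₁ η₂ * h ξ₁ ξ₂ := by
  simp [formTensor, mul_comm]

end Algebra

/-- The real-valued smooth functions on `M`. -/
abbrev RFun (m : ℕ) (M : Type*) [TopologicalSpace M] [ChartedSpace (EuclideanSpace ℝ (Fin m)) M] :=
  C^∞⟮𝓡 m, M; 𝓘(ℝ, ℝ), ℝ⟯

/-- `C^∞(M)`, the complex-valued smooth functions on `M`, with pointwise conjugation as `star`. -/
abbrev CFun (m : ℕ) (M : Type*) [TopologicalSpace M] [ChartedSpace (EuclideanSpace ℝ (Fin m)) M] :=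
  C^∞⟮𝓡 m, M; 𝓘(ℝ, ℂ), ℂ⟯

/-- The real smooth vector fields on `M`. -/
abbrev RVec (m : ℕ) (M : Type*) [TopologicalSpace M] [ChartedSpace (EuclideanSpace ℝ (Fin m)) M]
    [IsManifold (𝓡 m) ∞ M] :=
  Cₛ^∞⟮𝓡 m; EuclideanSpace ℝ (Fin m), (TangentSpace (𝓡 m) : M → Type)⟯

section
variable {m : ℕ} {M : Type*} [TopologicalSpace M] [ChartedSpace (EuclideanSpace ℝ (Fin m)) M]

instance : StarRing (CFun m M) where
  star f := ⟨fun x => star (f x), Complex.conjCLE.contDiff.contMDiff.comp f.contMDiff⟩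
  star_involutive f := by ext x; exact star_star (f x)
  star_mul f g := by ext x; exact star_mul (f x) (g x)
  star_add f g := by ext x; exact star_add (f x) (g x)

instance : Algebra (RFun m M) (CFun m M) :=
  Algebra.ofModule (fun r f g => by ext x; exact smul_mul_assoc (r x) (f x) (g x))
    (fun r f g => by ext x; exact mul_smul_comm (r x) (f x) (g x))

instance : StarRing (RFun m M) := starRingOfComm
instance : TrivialStar (RFun m M) := ⟨fun _ => rfl⟩
instance : StarModule (RFun m M) (CFun m M) := ⟨fun r f => by ext x; exact star_smul (r x) (f x)⟩

variable [IsManifold (𝓡 m) ∞ M]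
instance : Module (RFun m M) (RVec m M) where
  smul f v := ⟨fun x => f x • v x, f.contMDiff.smul_section v.contMDiff⟩
  one_smul v := by ext x; exact one_smul ℝ (v x)
  mul_smul f g v := by ext x; exact mul_smul (f x) (g x) (v x)
  smul_zero f := by ext x; exact smul_zero (f x)
  smul_add f v w := by ext x; exact smul_add (f x) (v x) (w x)
  add_smul f g v := by ext x; exact add_smul (f x) (g x) (v x)
  zero_smul v := by ext x; exact zero_smul ℝ (v x)

open Bundle in
/-- Smooth Riemannian metrics on `M`. -/
abbrev Metric (m : ℕ) (M : Type*) [TopologicalSpace M]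
    [ChartedSpace (EuclideanSpace ℝ (Fin m)) M] [IsManifold (𝓡 m) ∞ M] :=
  ContMDiffRiemannianMetric (𝓡 m) ∞ (EuclideanSpace ℝ (Fin m)) (TangentSpace (𝓡 m) : M → Type)

/-- `𝔛(M)`, the complex smooth vector fields on `M`, the complexification of the real ones. -/
abbrev CVec (m : ℕ) (M : Type*) [TopologicalSpace M] [ChartedSpace (EuclideanSpace ℝ (Fin m)) M]
    [IsManifold (𝓡 m) ∞ M] := CFun m M ⊗[RFun m M] RVec m M

/-- The bilinear form `(v, w) ↦ g(v, w)` on real vector fields. -/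
def _root_.Bundle.ContMDiffRiemannianMetric.bilin (g : Metric m M) :
    LinearMap.BilinForm (RFun m M) (RVec m M) :=
  LinearMap.mk₂ (RFun m M)
    (fun v w => ⟨fun x => g.inner x (v x) (w x), by
      intro x
      have := ContMDiff.clm_bundle_apply₂ (IM := 𝓡 m) (E₃ := Bundle.Trivial M ℝ) (F₃ := ℝ)
        g.contMDiff v.contMDiff w.contMDiff
      have := this x
      simp only [Bundle.contMDiffAt_totalSpace] at this
      exact this.2⟩)
    (by intro v v' w; ext x; exact congrArg (· (w x)) (map_add (g.inner x) (v x) (v' x)))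
    (by intro f v w; ext x; exact congrArg (· (w x)) (map_smul (g.inner x) (f x) (v x)))
    (by intro v w w'; ext x; exact map_add (g.inner x (v x)) (w x) (w' x))
    (by intro f v w; ext x; exact map_smul (g.inner x (v x)) (f x) (w x))

/-- The action `f ↦ v(f)` of a real vector field on complex functions. -/
def realAct : RVec m M →ₗ[RFun m M] (CFun m M → CFun m M) where
  toFun v f := ⟨fun x => (mfderiv (𝓡 m) 𝓘(ℝ, ℂ) f x (v x) : ℂ),
    (contMDiff_snd_tangentBundle_modelSpace ℂ 𝓘(ℝ, ℂ)).comp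
      ((f.contMDiff.contMDiff_tangentMap (m := ∞) (by simp)).comp v.contMDiff)⟩
  map_add' v w := by
    funext f; ext x; exact map_add (mfderiv (𝓡 m) 𝓘(ℝ, ℂ) f x) (v x) (w x)
  map_smul' r v := by
    funext f; ext x; exact map_smul (mfderiv (𝓡 m) 𝓘(ℝ, ℂ) f x) (r x) (v x)

instance : Invertible (2 : RFun m M) where
  invOf := algebraMap ℝ _ 2⁻¹
  invOf_mul_self := by rw [← map_ofNat (algebraMap ℝ (RFun m M)) 2, ← map_mul]; norm_num
  mul_invOf_self := by rw [← map_ofNat (algebraMap ℝ (RFun m M)) 2, ← map_mul]; norm_num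

instance : Invertible (2 : CFun m M) where
  invOf := algebraMap ℝ _ 2⁻¹
  invOf_mul_self := by rw [← map_ofNat (algebraMap ℝ (CFun m M)) 2, ← map_mul]; norm_num
  mul_invOf_self := by rw [← map_ofNat (algebraMap ℝ (CFun m M)) 2, ← map_mul]; norm_num

/-- The action `f ↦ X(f)` of a complex vector field on complex functions. -/
def cact : CVec m M →ₗ[CFun m M] (CFun m M → CFun m M) := realAct.liftBaseChange (CFun m M)

/-- The quadratic form of the complex bilinear extension of the metric, so that `Q(v) = g(v, v)` for
real `v`. -/
abbrev Q (g : Metric m M) : QuadraticForm (CFun m M) (CVec m M) :=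
  QuadraticForm.baseChange (CFun m M) g.bilin.toQuadraticMap

/-- `Cl(M)`, the complex Clifford algebra of the vector fields, with `X * X = g(X, X)`. -/
abbrev Cl (g : Metric m M) := CliffordAlgebra (Q g)

end

section
variable {n : ℕ} {B : Type*} [TopologicalSpace B] [ChartedSpace (EuclideanSpace ℝ (Fin n)) B]

/-- The differential of a real function at a point. -/
def realDiff (f : RFun n B) (x : B) : TangentSpace (𝓡 n) x →L[ℝ] ℝ :=
  mfderiv (𝓡 n) 𝓘(ℝ, ℝ) f x

variable [IsManifold (𝓡 n) ∞ B]

/-- Functions `F i` and vector fields `Z i` with `v = ∑ dF i (v) Z i` for every tangent vector `v`. -/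
theorem exists_frame [CompactSpace B] [T2Space B] :
    ∃ (N : ℕ) (F : Fin N → RFun n B) (Z : Fin N → RVec n B),
      ∀ (x : B) (v : TangentSpace (𝓡 n) x), ∑ i, realDiff (F i) x v • Z i x = v := by
  obtain ⟨ι₀, f, -⟩ := SmoothBumpCovering.exists_isSubordinate (𝓡 n) (isClosed_univ (X := B))
    fun (x : B) _ => Filter.univ_mem
  have : Fintype ι₀ := f.fintype
  let U : ι₀ → Set B := fun k => interior {x | f k x = 1}
  obtain ⟨ρ, hρ⟩ := SmoothPartitionOfUnity.exists_isSubordinate (𝓡 n) (isClosed_univ (X := B)) U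
    (fun _ => isOpen_interior) (by
      intro x hx
      refine Set.mem_iUnion.2 ⟨f.ind x hx, ?_⟩
      exact mem_interior_iff_mem_nhds.2 (f.eventuallyEq_one x hx))
  have hU : ∀ k, U k ⊆ (chartAt (EuclideanSpace ℝ (Fin n)) (f.c k)).source := fun k x hx =>
    f.mem_chartAt_source_of_eq_one (show f k x = 1 from interior_subset (s := {x | f k x = 1}) hx)
  let e := fun k => trivializationAt (EuclideanSpace ℝ (Fin n)) (TangentSpace (𝓡 n)) (f.c k)
  let b := (EuclideanSpace.basisFun (Fin n) ℝ).toBasis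
  let F : ι₀ × Fin n → RFun n B := fun p =>
    ⟨fun x => f p.1 x • (extChartAt (𝓡 n) (f.c p.1) x) p.2,
      (f p.1).contMDiff_smul
        ((EuclideanSpace.proj (𝕜 := ℝ) p.2).contDiff.contMDiff.comp_contMDiffOn
          (contMDiffOn_extChartAt (I := 𝓡 n) (n := ∞) (x := f.c p.1)))⟩
  let Z : ι₀ × Fin n → RVec n B := fun p =>
    ⟨fun x => ρ p.1 x • (e p.1).localFrame b p.2 x,
      ContMDiffOn.smul_section_of_tsupport (ρ p.1).contMDiff.contMDiffOn
        (chartAt (EuclideanSpace ℝ (Fin n)) (f.c p.1)).open_source ((hρ p.1).trans (hU p.1))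
        ((e p.1).contMDiffOn_localFrame_baseSet ∞ b p.2)⟩
  have hF : ∀ p x, F p x = f p.1 x • (extChartAt (𝓡 n) (f.c p.1) x) p.2 := fun _ _ => rfl
  have hZ : ∀ p x, Z p x = ρ p.1 x • (e p.1).localFrame b p.2 x := fun _ _ => rfl
  have key : ∀ (x : B) (v : TangentSpace (𝓡 n) x), ∑ p, realDiff (F p) x v • Z p x = v := by
    intro x v
    have h1 : ∀ k : ι₀, ∑ j, realDiff (F (k, j)) x v • Z (k, j) x = ρ k x • v := by
      intro k
      by_cases hk : ρ k x = 0
      · have : ∀ j, Z (k, j) x = 0 := fun j => by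
          rw [hZ, hk, zero_smul]
        simp [this, hk]
      · have hxU : x ∈ U k := hρ k (subset_tsupport _ hk)
        have hxs := hU k hxU
        have hxe : x ∈ (e k).baseSet := hxs
        have hd : ∀ j, realDiff (F (k, j)) x v =
            b.repr ((e k).continuousLinearMapAt ℝ x v) j := by
          intro j
          rw [TangentBundle.continuousLinearMapAt_trivializationAt hxs]
          have hm := (hasMFDerivAt_extChartAt (I := 𝓡 n) hxs)
          have hcomp := ((EuclideanSpace.proj (𝕜 := ℝ) j).hasMFDerivAt
            (x := extChartAt (𝓡 n) (f.c k) x)).comp x hm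
          have heq : (F (k, j) : B → ℝ) =ᶠ[nhds x]
              (EuclideanSpace.proj (𝕜 := ℝ) j) ∘ extChartAt (𝓡 n) (f.c k) := by
            filter_upwards [mem_interior_iff_mem_nhds.1 hxU] with y hy
            rw [hF, show f k y = 1 from hy, one_smul]
            rfl
          have h3 := (hcomp.congr_of_eventuallyEq heq).mfderiv
          change mfderiv (𝓡 n) 𝓘(ℝ, ℝ) (F (k, j)) x v = _
          rw [h3, hm.mfderiv]
          rfl
        have hz : ∀ j, Z (k, j) x = ρ k x • (e k).basisAt b hxe j := fun j => by
          rw [hZ, (e k).localFrame_apply_of_mem_baseSet b hxe]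
        simp only [hd, hz]
        have h4 : ((e k).basisAt b hxe).repr v =
            b.repr ((e k).continuousLinearMapAt ℝ x v) := by
          rw [Bundle.Trivialization.continuousLinearMapAt_apply,
            Bundle.Trivialization.linearMapAt_def_of_mem _ hxe]
          simp [Bundle.Trivialization.basisAt, Module.Basis.map_repr]
        rw [← h4]
        conv_rhs => rw [← ((e k).basisAt b hxe).sum_repr v, Finset.smul_sum]
        exact Finset.sum_congr rfl fun j _ => smul_comm _ _ _
    rw [Fintype.sum_prod_type]
    simp only [h1]
    rw [← Finset.sum_smul]
    have := ρ.sum_eq_one (Set.mem_univ x)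
    rw [finsum_eq_sum_of_fintype] at this
    rw [this, one_smul]
  refine ⟨_, F ∘ (Fintype.equivFin _).symm, Z ∘ (Fintype.equivFin _).symm, fun x v => ?_⟩
  conv_rhs => rw [← key x v]
  exact (Fintype.equivFin (ι₀ × Fin n)).symm.sum_comp (fun p => realDiff (F p) x v • Z p x)
end

section
variable {m : ℕ} {M : Type*} [TopologicalSpace M] [ChartedSpace (EuclideanSpace ℝ (Fin m)) M]
  [IsManifold (𝓡 m) ∞ M]
  {n : ℕ} {B : Type*} [TopologicalSpace B] [ChartedSpace (EuclideanSpace ℝ (Fin n)) B]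
  [IsManifold (𝓡 n) ∞ B]

lemma cact_tmul (a : CFun m M) (v : RVec m M) (f : CFun m M) :
    cact (a ⊗ₜ v) f = a * realAct v f := by
  simp [cact]

lemma mfderiv_algebraMap (F : RFun n B) (x : B) (w : TangentSpace (𝓡 n) x) :
    (mfderiv (𝓡 n) 𝓘(ℝ, ℂ) (algebraMap (RFun n B) (CFun n B) F) x w : ℂ) =
      (realDiff F x w : ℂ) := by
  have h1 : HasMFDerivAt (𝓡 n) 𝓘(ℝ, ℝ) F x (mfderiv (𝓡 n) 𝓘(ℝ, ℝ) F x) :=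
    (F.contMDiff.mdifferentiableAt (by simp)).hasMFDerivAt
  have h2 := (Complex.ofRealCLM.hasMFDerivAt (x := F x)).comp x h1
  have h3 : ((algebraMap (RFun n B) (CFun n B) F : CFun n B) : B → ℂ) =
      Complex.ofRealCLM ∘ F := by
    funext y
    rw [Algebra.algebraMap_eq_smul_one]
    exact (Complex.real_smul.trans (mul_one _))
  rw [h3, h2.mfderiv]
  rfl

lemma realAct_apply (v : RVec m M) (f : CFun m M) (x : M) :
    realAct v f x = (mfderiv (𝓡 m) 𝓘(ℝ, ℂ) f x (v x) : ℂ) := rfl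

lemma realAct_comp (π : C^∞⟮𝓡 m, M; 𝓡 n, B⟯) (v : RVec m M) (f : CFun n B) (x : M) :
    realAct v (f.comp π) x =
      (mfderiv (𝓡 n) 𝓘(ℝ, ℂ) f (π x) (mfderiv (𝓡 m) (𝓡 n) π x (v x)) : ℂ) := by
  have := mfderiv_comp x (f.contMDiff.mdifferentiableAt (x := π x) (by simp))
    (π.contMDiff.mdifferentiableAt (x := x) (by simp))
  rw [realAct_apply]
  change mfderiv (𝓡 m) 𝓘(ℝ, ℂ) (f ∘ π) x (v x) = _
  rw [this]
  rfl

/-- `C^∞(M)` is regarded as a `C^∞(B)`-algebra through the pullback `f ↦ f ∘ π`. -/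
def IsPullbackAlgebra [Algebra (CFun n B) (CFun m M)] (π : C^∞⟮𝓡 m, M; 𝓡 n, B⟯) : Prop :=
  ∀ f : CFun n B, algebraMap (CFun n B) (CFun m M) f = f.comp π

variable [Algebra (CFun n B) (CFun m M)]

/-- Elements of `C^∞(M) ⊗ 𝔛(B)` as derivations `C^∞(B) → C^∞(M)`:
`(g ⊗ Y)(f) = g · (Y(f) ∘ π)`. -/
def pullAct : (CFun m M ⊗[CFun n B] CVec n B) →ₗ[CFun m M] (CFun n B → CFun m M) :=
  LinearMap.liftBaseChange (CFun m M)
    (LinearMap.compLeft (Algebra.linearMap (CFun n B) (CFun m M)) (CFun n B) ∘ₗ cact)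

lemma pullAct_tmul (g : CFun m M) (Y : CVec n B) (f : CFun n B) :
    pullAct (g ⊗ₜ[CFun n B] Y) f = g * algebraMap _ _ (cact Y f) := by
  simp [pullAct]

lemma frame_expand {N : ℕ} {F : Fin N → RFun n B} {Z : Fin N → RVec n B}
    (hFZ : ∀ (x : B) (v : TangentSpace (𝓡 n) x), ∑ i, realDiff (F i) x v • Z i x = v)
    (Y : CVec n B) :
    Y = ∑ i, cact Y (algebraMap (RFun n B) (CFun n B) (F i)) • ((1 : CFun n B) ⊗ₜ[RFun n B] Z i) := by
  induction Y using TensorProduct.induction_on with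
  | zero => simp
  | add x y hx hy =>
    conv_lhs => rw [hx, hy]
    simp [add_smul, Finset.sum_add_distrib]
  | tmul a v =>
    let r : Fin N → RFun n B := fun i =>
      ⟨fun x => (realAct v (algebraMap (RFun n B) (CFun n B) (F i)) x).re,
        Complex.reCLM.contDiff.contMDiff.comp (realAct v _).contMDiff⟩
    have hr : ∀ i, realAct v (algebraMap (RFun n B) (CFun n B) (F i)) =
        algebraMap (RFun n B) (CFun n B) (r i) := by
      intro i
      ext x
      rw [Algebra.algebraMap_eq_smul_one (r i), realAct_apply, mfderiv_algebraMap]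
      refine Eq.trans ?_ ((Complex.real_smul (x := r i x) (z := 1)).trans (mul_one _)).symm
      congr 1
      change _ = (mfderiv (𝓡 n) 𝓘(ℝ, ℂ) (algebraMap (RFun n B) (CFun n B) (F i)) x (v x) : ℂ).re
      rw [mfderiv_algebraMap, Complex.ofReal_re]
    have hv : v = ∑ i, r i • Z i := by
      ext x
      have hs : (∑ i, r i • Z i : RVec n B) x = ∑ i, r i x • Z i x := by
        have := map_sum (ContMDiffSection.coeAddHom (𝓡 n) (EuclideanSpace ℝ (Fin n)) ∞
          (TangentSpace (𝓡 n) : B → Type)) (fun i => r i • Z i) Finset.univ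
        have h2 := congrFun this x
        rw [Finset.sum_apply] at h2
        exact h2
      rw [hs, ← hFZ x (v x)]
      refine Finset.sum_congr rfl fun i _ => ?_
      congr 1
      change _ = (mfderiv (𝓡 n) 𝓘(ℝ, ℂ) (algebraMap (RFun n B) (CFun n B) (F i)) x (v x) : ℂ).re
      rw [mfderiv_algebraMap, Complex.ofReal_re]
    conv_lhs => rw [hv, TensorProduct.tmul_sum]
    refine Finset.sum_congr rfl fun i _ => ?_
    rw [cact_tmul, hr, mul_smul, algebraMap_smul, ← TensorProduct.tmul_smul, TensorProduct.smul_tmul',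
      smul_eq_mul, mul_one]

theorem pull_expand {N : ℕ} {F : Fin N → RFun n B} {Z : Fin N → RVec n B}
    (hFZ : ∀ (x : B) (v : TangentSpace (𝓡 n) x), ∑ i, realDiff (F i) x v • Z i x = v)
    (T : CFun m M ⊗[CFun n B] CVec n B) :
    T = ∑ i, pullAct T (algebraMap (RFun n B) (CFun n B) (F i)) ⊗ₜ[CFun n B]
        ((1 : CFun n B) ⊗ₜ[RFun n B] Z i) := by
  induction T with
  | zero => simp
  | add x y hx hy =>
    conv_lhs => rw [hx, hy]
    simp [TensorProduct.add_tmul, Finset.sum_add_distrib]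
  | tmul g Y =>
    conv_lhs => rw [frame_expand hFZ Y, TensorProduct.tmul_sum]
    refine Finset.sum_congr rfl fun i _ => ?_
    rw [← TensorProduct.smul_tmul, pullAct_tmul, Algebra.smul_def, mul_comm]

theorem pullAct_injective [CompactSpace B] [T2Space B] :
    Function.Injective (pullAct (M := M) (B := B) (m := m) (n := n)) := by
  obtain ⟨N, F, Z, hFZ⟩ := exists_frame (n := n) (B := B)
  intro S T h
  rw [pull_expand hFZ S, pull_expand hFZ T, h]

theorem exists_dpi [CompactSpace B] [T2Space B] (π : C^∞⟮𝓡 m, M; 𝓡 n, B⟯)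
    (hπ : IsPullbackAlgebra π) :
    ∃ L : CVec m M →ₗ[CFun m M] (CFun m M ⊗[CFun n B] CVec n B),
      ∀ (X : CVec m M) (f : CFun n B), pullAct (L X) f = cact X (algebraMap _ _ f) := by
  obtain ⟨N, F, Z, hFZ⟩ := exists_frame (n := n) (B := B)
  refine ⟨∑ i, ((LinearMap.proj (algebraMap _ _ (algebraMap (RFun n B) (CFun n B) (F i)))) ∘ₗ
      cact).smulRight ((1 : CFun m M) ⊗ₜ[CFun n B] ((1 : CFun n B) ⊗ₜ[RFun n B] Z i)), ?_⟩
  intro X f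
  induction X using TensorProduct.induction_on with
  | zero => simp
  | add x y hx hy => simp only [map_add, Pi.add_apply, hx, hy]
  | tmul a v =>
    simp only [LinearMap.sum_apply, LinearMap.smulRight_apply, LinearMap.comp_apply,
      LinearMap.proj_apply, cact_tmul, map_sum, map_smul, Finset.sum_apply, Pi.smul_apply,
      pullAct_tmul, one_mul, smul_eq_mul, mul_assoc]
    rw [← Finset.mul_sum]
    congr 1
    ext x
    simp only [hπ _]
    rw [realAct_comp]
    have hs : (∑ i, realAct v ((algebraMap (RFun n B) (CFun n B) (F i)).comp π) *
        (realAct (Z i) f).comp π : CFun m M) x = ∑ i,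
        realAct v ((algebraMap (RFun n B) (CFun n B) (F i)).comp π) x *
          realAct (Z i) f (π x) := by
      have := map_sum (ContMDiffMap.coeFnRingHom (I := 𝓡 m) (N := M) (I' := 𝓘(ℝ, ℂ)) (n := ∞) (R := ℂ))
        (fun i => realAct v ((algebraMap (RFun n B) (CFun n B) (F i)).comp π) *
          (realAct (Z i) f).comp π) Finset.univ
      have h2 := congrFun this x
      rw [Finset.sum_apply] at h2
      exact h2
    rw [hs]
    conv_rhs => rw [← hFZ (π x) (mfderiv (𝓡 m) (𝓡 n) π x (v x)), map_sum]
    refine Finset.sum_congr rfl fun i _ => ?_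
    rw [realAct_comp, mfderiv_algebraMap, map_smul]
    exact (Complex.real_smul).symm

/-- The differential `dπ : 𝔛(M) → C^∞(M) ⊗ 𝔛(B)`, determined by `dπ(X)(f) = X(f ∘ π)`. -/
def dpi [CompactSpace B] [T2Space B] {π : C^∞⟮𝓡 m, M; 𝓡 n, B⟯} (hπ : IsPullbackAlgebra π) :
    CVec m M →ₗ[CFun m M] (CFun m M ⊗[CFun n B] CVec n B) :=
  (exists_dpi π hπ).choose

lemma pullAct_dpi [CompactSpace B] [T2Space B] {π : C^∞⟮𝓡 m, M; 𝓡 n, B⟯}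
    (hπ : IsPullbackAlgebra π) (X : CVec m M) (f : CFun n B) :
    pullAct (dpi hπ X) f = cact X (algebraMap _ _ f) :=
  (exists_dpi π hπ).choose_spec X f
end

section Clifford
variable {A X : Type*} [CommRing A] [AddCommGroup X] [Module A X]
  (Q : QuadraticForm A X)

/-- The subalgebra of a Clifford algebra generated by a submodule of generators. -/
def subCl (p : Submodule A X) : Subalgebra A (CliffordAlgebra Q) :=
  Algebra.adjoin A (CliffordAlgebra.ι Q '' p)

/-- A generator of `subCl Q p`. -/
def subι (p : Submodule A X) : p →ₗ[A] subCl Q p :=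
  ((CliffordAlgebra.ι Q).domRestrict p).codRestrict (Subalgebra.toSubmodule (subCl Q p))
    fun x => Algebra.subset_adjoin ⟨x, x.2, rfl⟩

variable {Q}

lemma subι_coe {p : Submodule A X} (x : p) : (subι Q p x : CliffordAlgebra Q) =
  CliffordAlgebra.ι Q x := rfl

lemma includeLeft_injective [Invertible (2 : A)] {X' : Type*} [AddCommGroup X'] [Module A X'] (Q' : QuadraticForm A X') :
    Function.Injective (GradedTensorProduct.includeLeft (R := A)
      (CliffordAlgebra.evenOdd Q) (CliffordAlgebra.evenOdd Q')) := by
  let ε : CliffordAlgebra Q' →ₗ[A] A :=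
    (ExteriorAlgebra.algebraMapInv (R := A) (M := X')).toLinearMap ∘ₗ
      (CliffordAlgebra.equivExterior Q').toLinearMap
  have hε : ε 1 = 1 := by
    change ExteriorAlgebra.algebraMapInv
      (CliffordAlgebra.changeForm CliffordAlgebra.changeForm.associated_neg_proof 1) = 1
    rw [CliffordAlgebra.changeForm_one, map_one]
  refine Function.LeftInverse.injective
    (g := fun z => TensorProduct.rid A _ (TensorProduct.map LinearMap.id ε
      ((GradedTensorProduct.of A (CliffordAlgebra.evenOdd Q)
        (CliffordAlgebra.evenOdd Q')).symm z))) fun x => ?_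
  change TensorProduct.rid A _ (TensorProduct.map LinearMap.id ε (x ⊗ₜ[A] 1)) = x
  simp [hε]

/-- The inclusion of the Clifford algebra of an orthogonal summand. -/
lemma map_subtype_injective [Invertible (2 : A)] {p q : Submodule A X} (hpq : IsCompl p q)
    (ho : ∀ x ∈ p, ∀ y ∈ q, Q.IsOrtho x y) :
    Function.Injective (CliffordAlgebra.map
      (⟨p.subtype, fun _ => rfl⟩ : (Q.comp p.subtype) →qᵢ Q)) := by
  let e : Q →qᵢ ((Q.comp p.subtype).prod (Q.comp q.subtype)) :=
    ⟨(Submodule.prodEquivOfIsCompl p q hpq).symm.toLinearMap, fun x => by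
      obtain ⟨y, rfl⟩ := (Submodule.prodEquivOfIsCompl p q hpq).surjective x
      change ((Q.comp p.subtype).prod (Q.comp q.subtype))
        ((Submodule.prodEquivOfIsCompl p q hpq).symm (Submodule.prodEquivOfIsCompl p q hpq y)) = _
      rw [LinearEquiv.symm_apply_apply, Submodule.coe_prodEquivOfIsCompl']
      exact (QuadraticMap.isOrtho_def.1 (ho _ y.1.2 _ y.2.2)).symm⟩
  have h : ((CliffordAlgebra.ofProd (Q.comp p.subtype) (Q.comp q.subtype)).comp
      (CliffordAlgebra.map e)).comp (CliffordAlgebra.map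
      (⟨p.subtype, fun _ => rfl⟩ : (Q.comp p.subtype) →qᵢ Q)) =
      GradedTensorProduct.includeLeft _ _ := by
    ext x
    simp only [AlgHom.toLinearMap_apply, LinearMap.comp_apply, AlgHom.comp_apply,
      CliffordAlgebra.map_apply_ι]
    have : e (p.subtype x) = (x, 0) :=
      (LinearEquiv.symm_apply_eq _).2 (by simp)
    erw [this, CliffordAlgebra.ofProd_ι_mk]
    simp
  have h2 := includeLeft_injective (Q := Q.comp p.subtype) (Q.comp q.subtype)
  rw [← h] at h2
  exact fun x y hxy => h2 (by simp only [AlgHom.comp_apply]; exact congrArg _ (congrArg _ hxy))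

theorem exists_subClLift [Invertible (2 : A)] {p q : Submodule A X} (hpq : IsCompl p q)
    (ho : ∀ x ∈ p, ∀ y ∈ q, Q.IsOrtho x y) {C : Type*} [Ring C] [Algebra A C]
    (f : p →ₗ[A] C) (hf : ∀ x, f x * f x = algebraMap A C (Q x)) :
    ∃ F : subCl Q p →ₐ[A] C, ∀ x, F (subι Q p x) = f x := by
  let i := CliffordAlgebra.map (⟨p.subtype, fun _ => rfl⟩ : (Q.comp p.subtype) →qᵢ Q)
  have hrange : subCl Q p ≤ i.range := by
    refine Algebra.adjoin_le ?_
    rintro _ ⟨x, hx, rfl⟩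
    exact ⟨CliffordAlgebra.ι _ ⟨x, hx⟩, CliffordAlgebra.map_apply_ι _ _⟩
  let e := AlgEquiv.ofInjective i (map_subtype_injective hpq ho)
  refine ⟨((CliffordAlgebra.lift (Q.comp p.subtype)) ⟨f, hf⟩).comp
    ((e.symm : _ →ₐ[A] _).comp (Subalgebra.inclusion hrange)), fun x => ?_⟩
  have : e.symm (Subalgebra.inclusion hrange (subι Q p x)) = CliffordAlgebra.ι _ x := by
    rw [AlgEquiv.symm_apply_eq]
    refine Subtype.ext ?_
    exact (CliffordAlgebra.map_apply_ι
      (⟨p.subtype, fun _ => rfl⟩ : (Q.comp p.subtype) →qᵢ Q) x).symm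
  change CliffordAlgebra.lift (Q.comp p.subtype) ⟨f, hf⟩
    (e.symm (Subalgebra.inclusion hrange (subι Q p x))) = f x
  rw [this]
  exact CliffordAlgebra.lift_ι_apply _ _ _

theorem subCl_hom_ext {p : Submodule A X} {C : Type*} [Ring C] [Algebra A C]
    {F G : subCl Q p →ₐ[A] C} (h : ∀ x, F (subι Q p x) = G (subι Q p x)) : F = G := by
  refine AlgHom.ext fun ⟨x, hx⟩ => ?_
  induction hx using Algebra.adjoin_induction with
  | mem x hx =>
    obtain ⟨y, hy, rfl⟩ := hx
    exact h ⟨y, hy⟩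
  | algebraMap r => exact (F.commutes r).trans (G.commutes r).symm
  | add x y hx hy h1 h2 =>
    have := congrArg₂ (· + ·) h1 h2
    simp only [← map_add] at this
    exact this
  | mul x y hx hy h1 h2 =>
    have := congrArg₂ (· * ·) h1 h2
    simp only [← map_mul] at this
    exact this

lemma involute_mem_subCl {p : Submodule A X} {x : CliffordAlgebra Q} (hx : x ∈ subCl Q p) :
    CliffordAlgebra.involute x ∈ subCl Q p := by
  induction hx using Algebra.adjoin_induction with
  | mem x hx =>
    obtain ⟨y, hy, rfl⟩ := hx
    rw [CliffordAlgebra.involute_ι]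
    exact neg_mem (Algebra.subset_adjoin ⟨y, hy, rfl⟩)
  | algebraMap r => rw [AlgHom.commutes]; exact Subalgebra.algebraMap_mem _ r
  | add x y hx hy h1 h2 => rw [map_add]; exact add_mem h1 h2
  | mul x y hx hy h1 h2 => rw [map_mul]; exact mul_mem h1 h2

variable (Q) in
/-- The grading automorphism of `subCl Q p`. -/
def subInvolute (p : Submodule A X) : subCl Q p →ₐ[A] subCl Q p :=
  (CliffordAlgebra.involute.comp (subCl Q p).val).codRestrict _
    fun x => involute_mem_subCl x.2

lemma subInvolute_subι {p : Submodule A X} (x : p) :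
    subInvolute Q p (subι Q p x) = -subι Q p x :=
  Subtype.ext (CliffordAlgebra.involute_ι (x : X))

lemma ι_mul_subCl {p : Submodule A X} {y : X} (hy : ∀ x ∈ p, Q.IsOrtho x y) (x : subCl Q p) :
    CliffordAlgebra.ι Q y * x = (subInvolute Q p x : CliffordAlgebra Q) * CliffordAlgebra.ι Q y := by
  obtain ⟨x, hx⟩ := x
  change CliffordAlgebra.ι Q y * x = CliffordAlgebra.involute x * CliffordAlgebra.ι Q y
  induction hx using Algebra.adjoin_induction with
  | mem x hx =>
    obtain ⟨z, hz, rfl⟩ := hx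
    rw [CliffordAlgebra.involute_ι, CliffordAlgebra.ι_mul_ι_comm_of_isOrtho (hy z hz).symm, neg_mul]
  | algebraMap r => rw [AlgHom.commutes, Algebra.commutes]
  | add a b ha hb h1 h2 => rw [map_add, mul_add, add_mul, h1, h2]
  | mul a b ha hb h1 h2 => rw [map_mul, ← mul_assoc, h1, mul_assoc, h2, mul_assoc]

variable (Q) in
/-- The `ℤ/2`-grading of `subCl Q p` inherited from the Clifford algebra. -/
def subGr (p : Submodule A X) (i : ZMod 2) : Submodule A (subCl Q p) :=
  (CliffordAlgebra.evenOdd Q i).comap (subCl Q p).val.toLinearMap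

lemma subGr_isCompl [Invertible (2 : A)] (p : Submodule A X) :
    IsCompl (subGr Q p 0) (subGr Q p 1) := by
  have hc := CliffordAlgebra.evenOdd_isCompl (Q := Q)
  constructor
  · rw [Submodule.disjoint_def]
    exact fun x h0 h1 => Subtype.ext (Submodule.disjoint_def.1 hc.disjoint x h0 h1)
  · rw [codisjoint_iff, Submodule.eq_top_iff']
    intro x
    obtain ⟨a, ha, b, hb, hab⟩ := Submodule.mem_sup.1
      (hc.sup_eq_top ▸ Submodule.mem_top : (x : CliffordAlgebra Q) ∈ _ ⊔ _)
    have hi : CliffordAlgebra.involute (x : CliffordAlgebra Q) = a - b := by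
      rw [← hab, map_add, CliffordAlgebra.involute_eq_of_mem_even ha,
        CliffordAlgebra.involute_eq_of_mem_odd hb, sub_eq_add_neg]
    have h2 : ∀ z : CliffordAlgebra Q, (⅟2 : A) • (z + z) = z := fun z => by
      rw [← two_smul A z, smul_smul, invOf_mul_self, one_smul]
    have ha' : a ∈ subCl Q p := by
      have : a = (⅟2 : A) • ((x : CliffordAlgebra Q) + CliffordAlgebra.involute (x : CliffordAlgebra Q)) := by
        rw [hi, ← hab, add_add_sub_cancel, h2]
      rw [this]
      exact Subalgebra.smul_mem _ (add_mem x.2 (involute_mem_subCl x.2)) _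
    have hb' : b ∈ subCl Q p := by
      have : b = x - a := by rw [← hab, add_sub_cancel_left]
      rw [this]
      exact sub_mem x.2 ha'
    exact Submodule.mem_sup.2 ⟨⟨a, ha'⟩, ha, ⟨b, hb'⟩, hb, Subtype.ext hab⟩

instance subGr_gradedAlgebra [Invertible (2 : A)] (p : Submodule A X) :
    GradedAlgebra (subGr Q p) where
  one_mem := SetLike.one_mem_graded (CliffordAlgebra.evenOdd Q)
  mul_mem _ _ _ _ ha hb := SetLike.mul_mem_graded (A := CliffordAlgebra.evenOdd Q) ha hb
  toDecomposition := ((DirectSum.isInternal_submodule_iff_isCompl (subGr Q p) (i := 0) (j := 1)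
    zero_ne_one (by
      have : (Finset.univ : Finset (ZMod 2)) = {0, 1} := rfl
      simpa using congrArg ((↑) : Finset (ZMod 2) → Set (ZMod 2)) this)).2 (subGr_isCompl p)).chooseDecomposition

lemma subCl_conj {p : Submodule A X} {C : Type*} [Ring C] [Algebra A C] (F : subCl Q p →ₐ[A] C)
    (γ : C) (hγ : ∀ x, F (subι Q p x) * γ + γ * F (subι Q p x) = 0) (x : subCl Q p) :
    F x * γ = γ * F (subInvolute Q p x) := by
  obtain ⟨x, hx⟩ := x
  induction hx using Algebra.adjoin_induction with
  | mem x hx =>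
    obtain ⟨z, hz, rfl⟩ := hx
    change F (subι Q p ⟨z, hz⟩) * γ = γ * F (subInvolute Q p (subι Q p ⟨z, hz⟩))
    rw [subInvolute_subι, map_neg, mul_neg]
    exact eq_neg_of_add_eq_zero_left (hγ _)
  | algebraMap r =>
    change F (algebraMap A _ r) * γ = γ * F (subInvolute Q p (algebraMap A _ r))
    rw [AlgHom.commutes, AlgHom.commutes, AlgHom.commutes, Algebra.commutes]
  | add a b ha hb h1 h2 =>
    change F (⟨a, ha⟩ + ⟨b, hb⟩) * γ = γ * F (subInvolute Q p (⟨a, ha⟩ + ⟨b, hb⟩))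
    simp only [map_add, mul_add, add_mul, h1, h2]
  | mul a b ha hb h1 h2 =>
    change F (⟨a, ha⟩ * ⟨b, hb⟩) * γ = γ * F (subInvolute Q p (⟨a, ha⟩ * ⟨b, hb⟩))
    rw [map_mul, map_mul, map_mul, mul_assoc, h2, ← mul_assoc, h1, mul_assoc]

end Clifford

section Balanced
variable {A S D E : Type*} [CommRing A] [AddCommGroup D] [Module A D]
  [AddCommGroup E] [Module A E] (r : S → Module.End A D) (c : S → Module.End A E)

/-- The submodule of `D ⊗ E` spanned by the relations `φ·x ⊗ s - φ ⊗ x·s` for `x` in `S`, where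
`S` acts on `D` (from the right) through `r` and on `E` through `c`. -/
def balRel : Submodule A (D ⊗[A] E) :=
  Submodule.span A {z | ∃ (φ : D) (x : S) (s : E), z = r x φ ⊗ₜ[A] s - φ ⊗ₜ[A] c x s}

/-- The balanced tensor product `D ⊗_S E`, an `A`-module. -/
abbrev BalTensor := (D ⊗[A] E) ⧸ balRel r c

/-- The class of `φ ⊗ s` in `D ⊗_S E`. -/
def BalTensor.tmul (φ : D) (s : E) : BalTensor r c := (balRel r c).mkQ (φ ⊗ₜ s)

variable {r c}

/-- The operator `φ ⊗ s ↦ α φ ⊗ β s` on `D ⊗_S E`, for `α` and `β` that intertwine the actions of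
`S` up to the same change of the element of `S`. -/
def BalTensor.map (α : Module.End A D) (β : Module.End A E)
    (h : ∀ x, ∃ x', (∀ φ, α (r x φ) = r x' (α φ)) ∧ ∀ s, β (c x s) = c x' (β s)) :
    Module.End A (BalTensor r c) :=
  Submodule.mapQ _ _ (TensorProduct.map α β) (by
    rw [balRel, Submodule.span_le]
    rintro _ ⟨φ, x, s, rfl⟩
    obtain ⟨x', h1, h2⟩ := h x
    refine Submodule.subset_span ⟨α φ, x', β s, ?_⟩
    rw [map_sub, TensorProduct.map_tmul, TensorProduct.map_tmul, h1, h2])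

lemma BalTensor.map_tmul (α : Module.End A D) (β : Module.End A E)
    (h : ∀ x, ∃ x', (∀ φ, α (r x φ) = r x' (α φ)) ∧ ∀ s, β (c x s) = c x' (β s)) (φ : D) (s : E) :
    BalTensor.map α β h (BalTensor.tmul r c φ s) = BalTensor.tmul r c (α φ) (β s) := rfl

lemma BalTensor.hom_ext {P : Type*} [AddCommGroup P] [Module A P] {f g : BalTensor r c →ₗ[A] P}
    (h : ∀ φ s, f (BalTensor.tmul r c φ s) = g (BalTensor.tmul r c φ s)) : f = g :=
  Submodule.linearMap_qext _ (TensorProduct.ext' h)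

/-- The operators `φ ⊗ s ↦ α φ ⊗ β(X) s` on `D ⊗_S E`, linear in `X`. -/
def BalTensor.mapLin {P : Type*} [AddCommGroup P] [Module A P] (α : Module.End A D)
    (β : P →ₗ[A] Module.End A E)
    (h : ∀ X x, ∃ x', (∀ φ, α (r x φ) = r x' (α φ)) ∧ ∀ s, β X (c x s) = c x' (β X s)) :
    P →ₗ[A] Module.End A (BalTensor r c) where
  toFun X := BalTensor.map α (β X) (h X)
  map_add' X Y := BalTensor.hom_ext fun φ s => by
    rw [LinearMap.add_apply, BalTensor.map_tmul, BalTensor.map_tmul, BalTensor.map_tmul,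
      map_add, LinearMap.add_apply]
    simp only [BalTensor.tmul, TensorProduct.tmul_add, map_add]
  map_smul' f X := BalTensor.hom_ext fun φ s => by
    rw [LinearMap.smul_apply, BalTensor.map_tmul, BalTensor.map_tmul, map_smul,
      LinearMap.smul_apply]
    simp only [BalTensor.tmul, TensorProduct.tmul_smul, map_smul, RingHom.id_apply]

lemma BalTensor.mapLin_tmul {P : Type*} [AddCommGroup P] [Module A P] (α : Module.End A D)
    (β : P →ₗ[A] Module.End A E)
    (h : ∀ X x, ∃ x', (∀ φ, α (r x φ) = r x' (α φ)) ∧ ∀ s, β X (c x s) = c x' (β X s))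
    (X : P) (φ : D) (s : E) :
    BalTensor.mapLin α β h X (BalTensor.tmul r c φ s) = BalTensor.tmul r c (α φ) (β X s) := rfl

lemma BalTensor.mapLin_sq {P : Type*} [AddCommGroup P] [Module A P] (α : Module.End A D)
    (β : P →ₗ[A] Module.End A E)
    (h : ∀ X x, ∃ x', (∀ φ, α (r x φ) = r x' (α φ)) ∧ ∀ s, β X (c x s) = c x' (β X s))
    (X : P) (a : A) (hα : ∀ φ, α (α φ) = φ) (hβ : β X * β X = algebraMap _ _ a) :
    BalTensor.mapLin α β h X * BalTensor.mapLin α β h X = algebraMap _ _ a :=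
  BalTensor.hom_ext fun φ s => by
    have hs : β X (β X s) = a • s := LinearMap.congr_fun hβ s
    rw [Module.End.mul_apply, mapLin_tmul, mapLin_tmul, hα, hs, Module.algebraMap_end_apply]
    simp only [BalTensor.tmul, TensorProduct.tmul_smul, map_smul]

/-- The transpose `φ ↦ φ ∘ α` of an endomorphism. -/
def transpose (α : Module.End A D) : Module.End A (Module.Dual A D) := Module.Dual.transpose α

lemma transpose_apply (α : Module.End A D) (φ : Module.Dual A D) : transpose α φ = φ ∘ₗ α := rfl

end Balanced
section
variable {m : ℕ} {M : Type*} [TopologicalSpace M] [ChartedSpace (EuclideanSpace ℝ (Fin m)) M]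
  [IsManifold (𝓡 m) ∞ M]

/-- The hermitian form `⟨a ⊗ v, b ⊗ w⟩ = ā g(v, w) b` on complex vector fields. -/
def vecForm (g : Metric m M) : SesqForm (CFun m M) (CVec m M) :=
  formBaseChange (R := RFun m M) (algebraMap_star_comm (R := RFun m M) (A := CFun m M))
    { toFun := g.bilin, map_add' := map_add _, map_smul' := fun r v => by
        rw [starRingEnd_apply, star_trivial]; exact map_smul g.bilin r v }

/-- The involution of the Clifford algebra: conjugate-linear, anti-multiplicative, and the identity
on real vector fields. -/
def clStar (g : Metric m M) (x : Cl g) : Cl g :=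
  CliffordAlgebra.ofBaseChange (CFun m M) g.bilin.toQuadraticMap
    (TensorProduct.map
      ({ toFun := star, map_add' := star_add, map_smul' := fun r f => by
          rw [star_smul, star_trivial]; rfl } : CFun m M →ₗ[RFun m M] CFun m M)
      CliffordAlgebra.reverse
      (CliffordAlgebra.toBaseChange (CFun m M) g.bilin.toQuadraticMap x))

lemma clStar_ι (g : Metric m M) (a : CFun m M) (v : RVec m M) :
    clStar g (CliffordAlgebra.ι (Q g) (a ⊗ₜ v)) = CliffordAlgebra.ι (Q g) (star a ⊗ₜ v) := by
  simp [clStar]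

/-- The structure of a spinor module on `E`: a finitely generated projective, `ℤ/2`-graded hermitian
`C^∞(M)`-module with an isomorphism `c : Cl(M) → End(E)` of `ℤ/2`-graded `*`-algebras. -/
structure SpinorModule (g : Metric m M) (E : Type*) [AddCommGroup E] [Module (CFun m M) E] where
  finite : Module.Finite (CFun m M) E
  projective : Module.Projective (CFun m M) E
  /-- the hermitian form -/
  form : SesqForm (CFun m M) E
  /-- the form is hermitian, positive, and identifies `E` with its conjugate dual -/
  form_symm : ∀ s t, star (form s t) = form t s
  form_pos : ∀ s x, 0 ≤ (form s s x).re
  form_perfect : Function.Bijective form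
  /-- the grading operator -/
  grading : Module.End (CFun m M) E
  grading_sq : grading * grading = 1
  /-- the grading operator is unitary, hence selfadjoint -/
  grading_form : ∀ s t, form (grading s) (grading t) = form s t
  /-- the Clifford action -/
  cliff : Cl g ≃ₐ[CFun m M] Module.End (CFun m M) E
  /-- the action respects the gradings and the involutions -/
  cliff_grading : ∀ x, cliff (CliffordAlgebra.involute x) = grading * cliff x * grading
  cliff_star : ∀ x s t, form (cliff x s) t = form s (cliff (clStar g x) t)
end

section
variable {m : ℕ} {M : Type*} [TopologicalSpace M] [ChartedSpace (EuclideanSpace ℝ (Fin m)) M]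
  [IsManifold (𝓡 m) ∞ M]
  {n : ℕ} {B : Type*} [TopologicalSpace B] [ChartedSpace (EuclideanSpace ℝ (Fin n)) B]
  [IsManifold (𝓡 n) ∞ B] [CompactSpace B] [T2Space B]
  [Algebra (CFun n B) (CFun m M)] {π : C^∞⟮𝓡 m, M; 𝓡 n, B⟯}

lemma IsPullbackAlgebra.star (hπ : IsPullbackAlgebra π) (f : CFun n B) :
    algebraMap (CFun n B) (CFun m M) (star f) = star (algebraMap (CFun n B) (CFun m M) f) := by
  rw [hπ, hπ]; rfl

/-- The hermitian form `⟨f ⊗ Y, g ⊗ Z⟩ = f̄ (⟨Y, Z⟩ ∘ π) g` on `C^∞(M) ⊗ 𝔛(B)`. -/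
def pullForm (gB : Metric n B) (hπ : IsPullbackAlgebra π) :
    SesqForm (CFun m M) (CFun m M ⊗[CFun n B] CVec n B) :=
  formBaseChange hπ.star (vecForm gB)

/-- `𝔛_V(M) = ker dπ`. -/
def vertical (hπ : IsPullbackAlgebra π) : Submodule (CFun m M) (CVec m M) := LinearMap.ker (dpi hπ)

/-- `𝔛_H(M) = (ker dπ)^⊥`. -/
def horizontal (gM : Metric m M) (hπ : IsPullbackAlgebra π) : Submodule (CFun m M) (CVec m M) where
  carrier := {X | ∀ Y ∈ vertical hπ, vecForm gM X Y = 0}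
  zero_mem' := by intro Y _; simp
  add_mem' := by intro X X' h h' Y hY; simp [h Y hY, h' Y hY]
  smul_mem' := by intro f X h Y hY; simp [h Y hY]

/-- `π` is a Riemannian submersion: `π` and `dπ` are surjective, and `dπ` restricts to an isometric
isomorphism from `(ker dπ)^⊥` onto `C^∞(M) ⊗ 𝔛(B)`. -/
structure IsRiemannianSubmersion (gM : Metric m M) (gB : Metric n B)
    (hπ : IsPullbackAlgebra π) : Prop where
  surjective : Function.Surjective π
  dpi_surjective : Function.Surjective (dpi hπ)
  bijective : Function.Bijective ((dpi hπ).domRestrict (horizontal gM hπ))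
  isometric : ∀ X ∈ horizontal gM hπ, ∀ Y ∈ horizontal gM hπ,
    pullForm gB hπ (dpi hπ X) (dpi hπ Y) = vecForm gM X Y

variable {gM : Metric m M} {gB : Metric n B} {hπ : IsPullbackAlgebra π}

lemma IsRiemannianSubmersion.isCompl (h : IsRiemannianSubmersion gM gB hπ) :
    IsCompl (horizontal gM hπ) (vertical hπ) := by
  constructor
  · rw [Submodule.disjoint_def]
    intro X hX hX'
    have : (⟨X, hX⟩ : horizontal gM hπ) = 0 := h.bijective.1 (by
      rw [map_zero]; exact hX')
    exact congrArg Subtype.val this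
  · rw [codisjoint_iff, Submodule.eq_top_iff']
    intro X
    obtain ⟨Y, hY⟩ := h.bijective.2 (dpi hπ X)
    refine Submodule.mem_sup.2 ⟨Y, Y.2, X - Y, ?_, add_sub_cancel _ _⟩
    change dpi hπ (X - Y) = 0
    rw [map_sub, sub_eq_zero]
    exact hY.symm

/-! ### Complex conjugation of vector fields -/

/-- `a ⊗ v ↦ ā ⊗ v`. -/
def conjVec : CVec m M →ₗ⋆[CFun m M] CVec m M :=
  starLift (R := RFun m M) ((TensorProduct.mk (RFun m M) (CFun m M) (RVec m M) 1).toAddMonoidHom)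
    (by
      intro r v
      rw [← algebraMap_star_comm, star_trivial, algebraMap_smul]
      exact map_smul (TensorProduct.mk (RFun m M) (CFun m M) (RVec m M) 1) r v)

lemma conjVec_tmul (a : CFun m M) (v : RVec m M) : conjVec (a ⊗ₜ v) = star a ⊗ₜ v := by
  change star a • ((1 : CFun m M) ⊗ₜ[RFun m M] v) = _
  rw [TensorProduct.smul_tmul', smul_eq_mul, mul_one]

lemma conjVec_conjVec (X : CVec m M) : conjVec (conjVec X) = X := by
  induction X using TensorProduct.induction_on with
  | zero => simp
  | add x y hx hy => rw [map_add, map_add, hx, hy]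
  | tmul a v => rw [conjVec_tmul, conjVec_tmul, star_star]

lemma cact_conjVec (X : CVec m M) (f : CFun m M) : cact (conjVec X) f = star (cact X (star f)) := by
  induction X using TensorProduct.induction_on with
  | zero => simp
  | add x y hx hy => simp only [map_add, Pi.add_apply, hx, hy, star_add]
  | tmul a v =>
    rw [conjVec_tmul, cact_tmul, cact_tmul, star_mul, mul_comm]
    congr 1
    ext x
    have h2 := (Complex.conjCLE.toContinuousLinearMap.hasMFDerivAt (x := f x)).comp x
      (f.contMDiff.mdifferentiableAt (x := x) (by simp)).hasMFDerivAt
    have h3 : realAct v (star f) x = star (realAct v f x) := by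
      rw [realAct_apply, realAct_apply]
      change mfderiv (𝓡 m) 𝓘(ℝ, ℂ) (Complex.conjCLE.toContinuousLinearMap ∘ f) x (v x) = _
      rw [h2.mfderiv]
      rfl
    change _ = star (realAct v (star f) x)
    rw [h3, star_star]

/-- `f ⊗ Y ↦ f̄ ⊗ Ȳ`. -/
def conjPull (hπ : IsPullbackAlgebra π) : (CFun m M ⊗[CFun n B] CVec n B) →ₗ⋆[CFun m M]
    (CFun m M ⊗[CFun n B] CVec n B) :=
  starLift (R := CFun n B)
    (((TensorProduct.mk (CFun n B) (CFun m M) (CVec n B) 1).toAddMonoidHom).comp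
      (conjVec (m := n) (M := B)).toAddMonoidHom)
    (by
      intro r v
      rw [← hπ.star, algebraMap_smul]
      change (1 : CFun m M) ⊗ₜ[CFun n B] conjVec (r • v) = _
      rw [map_smulₛₗ, TensorProduct.tmul_smul]
      rfl)

lemma conjPull_tmul (f : CFun m M) (Y : CVec n B) :
    conjPull hπ (f ⊗ₜ Y) = star f ⊗ₜ conjVec Y := by
  change star f • ((1 : CFun m M) ⊗ₜ[CFun n B] conjVec Y) = _
  rw [TensorProduct.smul_tmul', smul_eq_mul, mul_one]

lemma dpi_conjVec (X : CVec m M) : dpi hπ (conjVec X) = conjPull hπ (dpi hπ X) := by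
  refine pullAct_injective (funext fun f => ?_)
  have h : ∀ T : CFun m M ⊗[CFun n B] CVec n B,
      pullAct (conjPull hπ T) f = star (pullAct T (star f)) := by
    intro T
    induction T with
    | zero => simp
    | add x y hx hy => simp only [map_add, Pi.add_apply, hx, hy, star_add]
    | tmul g Y =>
      rw [conjPull_tmul, pullAct_tmul, pullAct_tmul, cact_conjVec, star_mul, mul_comm, hπ.star]
  rw [h, pullAct_dpi, pullAct_dpi, cact_conjVec, hπ.star]

lemma associated_tmul (g : Metric m M) (a b : CFun m M) (v w : RVec m M) :
    QuadraticMap.associated (Q g) (a ⊗ₜ v) (b ⊗ₜ w) = g.bilin v w • (a * b) := by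
  have hsymm : ∀ v w, g.bilin v w = g.bilin w v := fun v w => by
    ext x; exact g.symm x (v x) (w x)
  rw [QuadraticForm.associated_baseChange, QuadraticMap.associated_left_inverse _ hsymm,
    LinearMap.BilinForm.baseChange_tmul]

lemma vecForm_eq (g : Metric m M) (X Y : CVec m M) :
    vecForm g X Y = QuadraticMap.associated (Q g) (conjVec X) Y := by
  induction X using TensorProduct.induction_on with
  | zero => simp
  | add x y hx hy => simp only [map_add, LinearMap.add_apply, hx, hy]
  | tmul a v =>
    induction Y using TensorProduct.induction_on with
    | zero => simp
    | add x y hx hy => simp only [map_add, hx, hy]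
    | tmul b w =>
      rw [conjVec_tmul, associated_tmul, Algebra.smul_def]
      exact (formBaseChange_tmul _ _ _ _ _ _).trans (mul_left_comm _ _ _)

lemma associated_conjVec (g : Metric m M) (X Y : CVec m M) :
    QuadraticMap.associated (Q g) (conjVec X) (conjVec Y) =
      star (QuadraticMap.associated (Q g) X Y) := by
  induction X using TensorProduct.induction_on with
  | zero => simp
  | add x y hx hy => simp only [map_add, LinearMap.add_apply, hx, hy, star_add]
  | tmul a v =>
    induction Y using TensorProduct.induction_on with
    | zero => simp
    | add x y hx hy => simp only [map_add, hx, hy, star_add]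
    | tmul b w =>
      rw [conjVec_tmul, conjVec_tmul, associated_tmul, associated_tmul, star_smul,
        star_trivial (g.bilin v w), star_mul, mul_comm (star a)]

lemma pullForm_eq (S T : CFun m M ⊗[CFun n B] CVec n B) :
    pullForm gB hπ S T =
      QuadraticMap.associated ((Q gB).baseChange (CFun m M)) (conjPull hπ S) T := by
  induction S using TensorProduct.induction_on with
  | zero => simp
  | add x y hx hy => simp only [map_add, LinearMap.add_apply, hx, hy]
  | tmul a v =>
    induction T using TensorProduct.induction_on with
    | zero => simp
    | add x y hx hy => simp only [map_add, hx, hy]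
    | tmul b w =>
      rw [conjPull_tmul, QuadraticForm.associated_baseChange, LinearMap.BilinForm.baseChange_tmul,
        Algebra.smul_def, ← vecForm_eq]
      exact (formBaseChange_tmul _ _ _ _ _ _).trans (mul_left_comm _ _ _)

lemma conjVec_vertical {X : CVec m M} (hX : X ∈ vertical hπ) : conjVec X ∈ vertical hπ := by
  change dpi hπ (conjVec X) = 0
  rw [dpi_conjVec, show dpi hπ X = 0 from hX, map_zero]

lemma associated_hor_vert {X Y : CVec m M} (hX : X ∈ horizontal gM hπ) (hY : Y ∈ vertical hπ) :
    QuadraticMap.associated (Q gM) X Y = 0 := by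
  have := hX _ (conjVec_vertical hY)
  rw [vecForm_eq, associated_conjVec, star_eq_zero] at this
  exact this

lemma conjVec_horizontal {X : CVec m M} (hX : X ∈ horizontal gM hπ) :
    conjVec X ∈ horizontal gM hπ := by
  intro Y hY
  rw [vecForm_eq, conjVec_conjVec, associated_hor_vert hX hY]

lemma isOrtho_hor_vert : ∀ X ∈ horizontal gM hπ, ∀ Y ∈ vertical hπ, (Q gM).IsOrtho X Y :=
  fun _ hX _ hY => QuadraticMap.associated_isOrtho.1 (associated_hor_vert hX hY)

lemma IsRiemannianSubmersion.quadratic (h : IsRiemannianSubmersion gM gB hπ) {X : CVec m M}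
    (hX : X ∈ horizontal gM hπ) :
    (Q gB).baseChange (CFun m M) (dpi hπ X) = Q gM X := by
  have := h.isometric _ (conjVec_horizontal hX) _ hX
  rw [pullForm_eq, vecForm_eq, conjVec_conjVec, ← dpi_conjVec, conjVec_conjVec,
    QuadraticMap.associated_eq_self_apply, QuadraticMap.associated_eq_self_apply] at this
  exact this

/-! ### Spinor modules -/

variable {EB : Type*} [AddCommGroup EB] [Module (CFun n B) EB]
  {EM : Type*} [AddCommGroup EM] [Module (CFun m M) EM]

variable (m M n B) in
/-- The horizontal spinor module `E_H`, the pullback of `E_B`. -/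
abbrev HSpinor (EB : Type*) [AddCommGroup EB] [Module (CFun n B) EB] :=
  CFun m M ⊗[CFun n B] EB

/-- The hermitian form on `E_H`: `⟨f ⊗ s, g ⊗ t⟩ = f̄ (⟨s, t⟩ ∘ π) g`. -/
def hForm (hπ : IsPullbackAlgebra π) (SB : SpinorModule gB EB) :
    SesqForm (CFun m M) (HSpinor m M n B EB) :=
  formBaseChange hπ.star SB.form

/-- The grading operator `γ_H = 1 ⊗ γ_B` of `E_H`. -/
def hGrading (SB : SpinorModule gB EB) : Module.End (CFun m M) (HSpinor m M n B EB) :=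
  SB.grading.baseChange (CFun m M)

/-- The Clifford action of `C^∞(M) ⊗ 𝔛(B)` on `E_H`: `c̃(f ⊗ Y)(g ⊗ t) = f g ⊗ c(Y) t`. -/
def cTilde (SB : SpinorModule gB EB) : (CFun m M ⊗[CFun n B] CVec n B) →ₗ[CFun m M]
    Module.End (CFun m M) (HSpinor m M n B EB) :=
  LinearMap.liftBaseChange (CFun m M)
    (LinearMap.baseChangeHom (CFun n B) (CFun m M) EB EB ∘ₗ
      SB.cliff.toLinearMap ∘ₗ CliffordAlgebra.ι (Q gB))

lemma cTilde_tmul (SB : SpinorModule gB EB) (f : CFun m M) (Y : CVec n B) :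
    cTilde SB (f ⊗ₜ Y) = f • (SB.cliff (CliffordAlgebra.ι (Q gB) Y)).baseChange (CFun m M) := by
  simp [cTilde]

lemma cTilde_sq (SB : SpinorModule gB EB) (T : CFun m M ⊗[CFun n B] CVec n B) :
    cTilde SB T * cTilde SB T = algebraMap _ _ ((Q gB).baseChange (CFun m M) T) := by
  let G₀ : Cl gB →ₐ[CFun n B] Module.End (CFun m M) (HSpinor m M n B EB) :=
    (Module.End.baseChangeHom (CFun n B) (CFun m M) EB).comp SB.cliff.toAlgHom
  let G : (CFun m M ⊗[CFun n B] Cl gB) →ₐ[CFun m M] Module.End (CFun m M) (HSpinor m M n B EB) :=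
    Algebra.TensorProduct.lift (Algebra.ofId _ _) G₀ fun a x => Algebra.commute_algebraMap_left a (G₀ x)
  have h : cTilde SB T = G (CliffordAlgebra.toBaseChange (CFun m M) (Q gB) (CliffordAlgebra.ι _ T)) := by
    induction T with
    | zero => simp
    | add x y hx hy => simp only [map_add, hx, hy]
    | tmul f Y =>
      rw [cTilde_tmul, CliffordAlgebra.toBaseChange_ι]
      exact (Algebra.smul_def f (G₀ _)).trans
        (Algebra.TensorProduct.lift_tmul (Algebra.ofId _ _) G₀ _ f _).symm
  rw [h, ← map_mul, ← map_mul, CliffordAlgebra.ι_sq_scalar, AlgHom.commutes, AlgHom.commutes]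

end
section
variable {m : ℕ} {M : Type*} [TopologicalSpace M] [ChartedSpace (EuclideanSpace ℝ (Fin m)) M]
  [IsManifold (𝓡 m) ∞ M]
  {n : ℕ} {B : Type*} [TopologicalSpace B] [ChartedSpace (EuclideanSpace ℝ (Fin n)) B]
  [IsManifold (𝓡 n) ∞ B] [CompactSpace B] [T2Space B]
  [Algebra (CFun n B) (CFun m M)] {π : C^∞⟮𝓡 m, M; 𝓡 n, B⟯}
  {gM : Metric m M} {gB : Metric n B} {hπ : IsPullbackAlgebra π}
  {EB : Type*} [AddCommGroup EB] [Module (CFun n B) EB]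
  {EM : Type*} [AddCommGroup EM] [Module (CFun m M) EM]
variable (gM) in
/-- `Cl_H(M)`, the subalgebra of `Cl(M)` generated by the horizontal vector fields. -/
abbrev ClH (hπ : IsPullbackAlgebra π) : Subalgebra (CFun m M) (Cl gM) :=
  subCl (Q gM) (horizontal gM hπ)

variable (gM) in
/-- `Cl_V(M)`, the subalgebra of `Cl(M)` generated by the vertical vector fields. -/
abbrev ClV (hπ : IsPullbackAlgebra π) : Subalgebra (CFun m M) (Cl gM) :=
  subCl (Q gM) (vertical hπ)

variable (gM) in
/-- The even and odd parts of `Cl_H(M)`. -/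
abbrev grH (hπ : IsPullbackAlgebra π) : ZMod 2 → Submodule (CFun m M) (ClH gM hπ) :=
  subGr (Q gM) (horizontal gM hπ)

variable (gM) in
/-- The even and odd parts of `Cl_V(M)`. -/
abbrev grV (hπ : IsPullbackAlgebra π) : ZMod 2 → Submodule (CFun m M) (ClV gM hπ) :=
  subGr (Q gM) (vertical hπ)

variable (h : IsRiemannianSubmersion gM gB hπ) (SB : SpinorModule gB EB) (SM : SpinorModule gM EM)

theorem exists_cH (h : IsRiemannianSubmersion gM gB hπ) (SB : SpinorModule gB EB) :
    ∃ F : ClH gM hπ →ₐ[CFun m M] Module.End (CFun m M) (HSpinor m M n B EB),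
    ∀ X, F (subι (Q gM) (horizontal gM hπ) X) = cTilde SB (dpi hπ X) :=
  exists_subClLift (C := Module.End (CFun m M) (HSpinor m M n B EB)) h.isCompl isOrtho_hor_vert
    (cTilde (m := m) (M := M) SB ∘ₗ (dpi hπ).domRestrict (horizontal gM hπ)) fun X => by
      rw [← h.quadratic X.2]
      exact cTilde_sq SB (dpi hπ X)

/-- The horizontal Clifford action: the algebra homomorphism with `c_H(X) = c̃(dπ(X))`. -/
def cH : ClH gM hπ →ₐ[CFun m M] Module.End (CFun m M) (HSpinor m M n B EB) :=
  (exists_cH h SB).choose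

lemma cH_subι (X : horizontal gM hπ) :
    cH h SB (subι (Q gM) (horizontal gM hπ) X) = cTilde SB (dpi hπ X) :=
  (exists_cH h SB).choose_spec X

/-- The vertical spinor module `E_V = E_H^* ⊗_{Cl_H(M)} E_M`, where `x` in `Cl_H(M)` acts on the dual
`E_H^*` from the right by `φ ↦ φ ∘ c_H(x)` and on `E_M` from the left by `c(x)`. -/
def VSpinor :=
  BalTensor (fun x : ClH gM hπ => transpose (cH h SB x)) (fun x : ClH gM hπ => SM.cliff x)

instance : AddCommGroup (VSpinor h SB SM) :=
  inferInstanceAs (AddCommGroup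
    (BalTensor (fun x : ClH gM hπ => transpose (cH h SB x)) (fun x : ClH gM hπ => SM.cliff x)))

instance : Module (CFun m M) (VSpinor h SB SM) :=
  inferInstanceAs (Module (CFun m M)
    (BalTensor (fun x : ClH gM hπ => transpose (cH h SB x)) (fun x : ClH gM hπ => SM.cliff x)))

/-- The class of `φ ⊗ s` in `E_V`. -/
def VSpinor.tmul (φ : Module.Dual (CFun m M) (HSpinor m M n B EB)) (s : EM) : VSpinor h SB SM :=
  BalTensor.tmul (fun x : ClH gM hπ => transpose (cH h SB x)) (fun x : ClH gM hπ => SM.cliff x) φ s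

lemma hGrading_sq : hGrading (m := m) (M := M) SB * hGrading SB = 1 := by
  rw [hGrading, ← LinearMap.baseChange_mul, SB.grading_sq, LinearMap.baseChange_one]

lemma cTilde_hGrading (T : CFun m M ⊗[CFun n B] CVec n B) :
    cTilde SB T * hGrading SB + hGrading SB * cTilde SB T = 0 := by
  induction T with
  | zero => rw [map_zero, zero_mul, mul_zero, add_zero]
  | add x y hx hy =>
    rw [map_add, add_mul, mul_add, add_add_add_comm, hx, hy, add_zero]
  | tmul f Y =>
    have h1 := SB.cliff_grading (CliffordAlgebra.ι (Q gB) Y)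
    rw [CliffordAlgebra.involute_ι, map_neg] at h1
    have h2 : SB.cliff (CliffordAlgebra.ι (Q gB) Y) * SB.grading +
        SB.grading * SB.cliff (CliffordAlgebra.ι (Q gB) Y) = 0 := by
      have h3 := congrArg (SB.grading * ·) h1
      simp only [← mul_assoc, SB.grading_sq, one_mul] at h3
      rw [← h3, mul_neg, neg_add_cancel]
    rw [cTilde_tmul, hGrading, smul_mul_assoc, ← LinearMap.baseChange_mul,
      mul_smul_comm, ← LinearMap.baseChange_mul, ← smul_add, ← LinearMap.baseChange_add, h2,
      LinearMap.baseChange_zero, smul_zero]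

lemma cH_hGrading (x : ClH gM hπ) :
    cH h SB x * hGrading SB = hGrading SB * cH h SB (subInvolute _ _ x) :=
  subCl_conj (C := Module.End (CFun m M) (HSpinor m M n B EB)) (cH h SB) (hGrading SB)
    (fun X => by rw [cH_subι]; exact cTilde_hGrading SB _) x

lemma cliff_vert_comm {X : CVec m M} (hX : X ∈ vertical hπ) (x : ClH gM hπ) :
    SM.cliff (CliffordAlgebra.ι (Q gM) X) * SM.cliff x =
      SM.cliff (subInvolute _ _ x : Cl gM) * SM.cliff (CliffordAlgebra.ι (Q gM) X) := by
  rw [← map_mul, ← map_mul, ι_mul_subCl fun Y hY => isOrtho_hor_vert Y hY X hX]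

lemma cliff_grading_comm (x : ClH gM hπ) :
    SM.grading * SM.cliff x = SM.cliff (subInvolute _ _ x : Cl gM) * SM.grading := by
  have := SM.cliff_grading x
  change _ = SM.cliff (CliffordAlgebra.involute (x : Cl gM)) * SM.grading
  rw [this, mul_assoc, SM.grading_sq, mul_one]

lemma balanced_aux (β : Module.End (CFun m M) EM)
    (hβ : ∀ x : ClH gM hπ, β * SM.cliff x = SM.cliff (subInvolute _ _ x : Cl gM) * β)
    (x : ClH gM hπ) : ∃ x' : ClH gM hπ,
      (∀ φ, transpose (hGrading SB) (transpose (cH h SB x) φ) =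
        transpose (cH h SB x') (transpose (hGrading SB) φ)) ∧
      ∀ s, β (SM.cliff x s) = SM.cliff x' (β s) :=
  ⟨subInvolute _ _ x, fun φ => congrArg (fun u => φ ∘ₗ u) (cH_hGrading h SB x),
    fun s => LinearMap.congr_fun (hβ x) s⟩

/-- The grading operator `γ_V = γ_H^* ⊗ γ_M` of `E_V`. -/
def vGrading : Module.End (CFun m M) (VSpinor h SB SM) :=
  BalTensor.map (transpose (hGrading SB)) SM.grading
    (balanced_aux h SB SM _ (cliff_grading_comm SM))

/-- The Clifford action of vertical vector fields on `E_M`. -/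
def cliffVert (hπ : IsPullbackAlgebra π) (SM : SpinorModule gM EM) :
    vertical hπ →ₗ[CFun m M] Module.End (CFun m M) EM :=
  SM.cliff.toLinearMap ∘ₗ (CliffordAlgebra.ι (Q gM)).domRestrict (vertical hπ)

/-- The operators `γ_H^* ⊗ c(X)` on `E_V` for vertical `X`. -/
def vGen : vertical hπ →ₗ[CFun m M] Module.End (CFun m M) (VSpinor h SB SM) :=
  BalTensor.mapLin (P := vertical hπ) (transpose (hGrading SB)) (cliffVert hπ SM)
    fun X => balanced_aux h SB SM (cliffVert hπ SM X) (cliff_vert_comm SM X.2)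

lemma vGen_tmul (X : vertical hπ) (φ : Module.Dual (CFun m M) (HSpinor m M n B EB)) (s : EM) :
    vGen h SB SM X (VSpinor.tmul h SB SM φ s) =
      VSpinor.tmul h SB SM (φ ∘ₗ hGrading SB) (SM.cliff (CliffordAlgebra.ι (Q gM) X) s) := rfl

lemma cliffVert_sq (X : vertical hπ) :
    cliffVert hπ SM X * cliffVert hπ SM X = algebraMap _ _ (Q gM X) := by
  change SM.cliff (CliffordAlgebra.ι (Q gM) X) * SM.cliff (CliffordAlgebra.ι (Q gM) X) = _
  rw [← map_mul, CliffordAlgebra.ι_sq_scalar, AlgEquiv.commutes]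

lemma hGrading_transpose_sq (φ : Module.Dual (CFun m M) (HSpinor m M n B EB)) :
    transpose (hGrading SB) (transpose (hGrading SB) φ) = φ :=
  congrArg (fun u : Module.End (CFun m M) (HSpinor m M n B EB) => φ ∘ₗ u) (hGrading_sq SB)

lemma vGen_sq (X : vertical hπ) :
    vGen h SB SM X * vGen h SB SM X =
      algebraMap (CFun m M) (Module.End (CFun m M) (VSpinor h SB SM)) (Q gM X) := by
  have h1 := hGrading_transpose_sq (m := m) (M := M) SB
  have h2 := cliffVert_sq SM X
  exact BalTensor.mapLin_sq _ _ _ _ _ h1 h2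

theorem exists_cV (h : IsRiemannianSubmersion gM gB hπ) (SB : SpinorModule gB EB)
    (SM : SpinorModule gM EM) :
    ∃ F : ClV gM hπ →ₐ[CFun m M] Module.End (CFun m M) (VSpinor h SB SM),
    ∀ X, F (subι (Q gM) (vertical hπ) X) = vGen h SB SM X :=
  exists_subClLift (C := Module.End (CFun m M) (VSpinor h SB SM)) h.isCompl.symm
    (fun X hX Y hY => (isOrtho_hor_vert Y hY X hX).symm) (vGen h SB SM) (vGen_sq h SB SM)

/-- The vertical Clifford action: the algebra homomorphism with `c_V(X) = γ_H^* ⊗ c(X)`. -/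
def cV : ClV gM hπ →ₐ[CFun m M] Module.End (CFun m M) (VSpinor h SB SM) :=
  (exists_cV h SB SM).choose

lemma cV_subι (X : vertical hπ) :
    cV h SB SM (subι (Q gM) (vertical hπ) X) = vGen h SB SM X :=
  (exists_cV h SB SM).choose_spec X

/-- The functional `⟨ξ| = ⟨ξ, ·⟩` on `E_H`. -/
def bra (hπ : IsPullbackAlgebra π) (SB : SpinorModule gB EB) (ξ : HSpinor m M n B EB) :
    Module.Dual (CFun m M) (HSpinor m M n B EB) := hForm hπ SB ξ

/-- The operator `|ξ₁⟩⟨ξ₂| : ζ ↦ ξ₁ ⟨ξ₂, ζ⟩` on `E_H`. -/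
def ketBra (hπ : IsPullbackAlgebra π) (SB : SpinorModule gB EB) (ξ₁ ξ₂ : HSpinor m M n B EB) :
    Module.End (CFun m M) (HSpinor m M n B EB) := (bra hπ SB ξ₂).smulRight ξ₁

variable {h SB SM} in
/-- The defining property of the form on `E_V`:
`⟨⟨ξ₁| ⊗ s₁, ⟨ξ₂| ⊗ s₂⟩ = ⟨s₁, c(x) s₂⟩`, where `x` in `Cl_H(M)` is the element with
`c_H(x) = |ξ₁⟩⟨ξ₂|`. -/
def IsVForm (hV : SesqForm (CFun m M) (VSpinor h SB SM)) : Prop :=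
  ∀ (ξ₁ ξ₂ : HSpinor m M n B EB) (s₁ s₂ : EM) (x : ClH gM hπ),
    cH h SB x = ketBra hπ SB ξ₁ ξ₂ →
      hV (VSpinor.tmul h SB SM (bra hπ SB ξ₁) s₁) (VSpinor.tmul h SB SM (bra hπ SB ξ₂) s₂) =
        SM.form s₁ (SM.cliff x s₂)
end
end SpinSub
end

open SpinSub

/-! The theorem is a case of Morita theory. Once `cH` is bijective, $S = \mathrm{Cl}_H(M)$ is the
full endomorphism algebra of $D = \mathscr{E}_H$. For such $S$ every $S$-module $E$ is recovered as
$D \otimes (D^* \otimes_S E)$: the map $\xi \otimes (\varphi \otimes s) \mapsto c(x)s$, where $x \in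
S$ acts on $D$ as the rank-one operator $|\xi\rangle\varphi$, is an isomorphism. With $E =
\mathscr{E}_M$ this is $\Phi$; here it is `contract`, made invertible in `IsFrame.contractEquiv`.

The finiteness enters through frames, families with $\xi = \sum_i \langle u_i, \xi\rangle e_i$. A
finitely generated projective module whose form maps onto the dual has one (`exists_isFrame`), and
frames survive base change (`IsFrame.baseChange`). So $\mathscr{E}_H$ inherits from $\mathscr{E}_B$
both a frame and the identification of vectors with functionals. The inverse of $\Phi$ is $s \mapsto
\sum_i e_i \otimes \langle u_i| \otimes s$.

`cH` is bijective because $d\pi$ turns horizontal fields into $C^\infty(M) \otimes \mathfrak{X}(B)$,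
Clifford algebras commute with base change, and so do endomorphism algebras of finitely generated
projective modules (`IsFrame.tensorProductEnd_bijective`).

The form on $\mathscr{E}_V$ is well defined, hermitian and compatible with $\Phi$ because each
element of $\mathrm{Cl}_H(M)$ has a single adjoint serving both $\mathscr{E}_H$ and $\mathscr{E}_M$
(`exists_adjoint`), and the adjoint of $|\xi\rangle\langle\zeta|$ is $|\zeta\rangle\langle\xi|$.

Gradings and vertical fields are handled together by `contract_twist`: $\gamma_M$ and $c(X)$, for
vertical $X$, both pass through $\mathrm{Cl}_H(M)$ by way of the grading automorphism, which on
$\mathscr{E}_H$ is conjugation by $\gamma_H$. Equivariance under the graded tensor product then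
follows from its generators. -/

noncomputable section
namespace SpinSub

/-! ### Frames for sesquilinear forms on finitely generated projective modules -/

section Frame
variable {A D ι : Type*} [CommRing A] [StarRing A] [AddCommGroup D] [Module A D] [Fintype ι]

/-- The families `u` and `e` form a frame for the sesquilinear form `k`: `ξ = ∑ ⟨u i, ξ⟩ e i`. -/
def IsFrame (k : SesqForm A D) (u e : ι → D) : Prop := ∀ ξ, ∑ i, k (u i) ξ • e i = ξ

/-- This is the dual basis lemma: a surjection $A^N \to D$ splits, and the coordinate functionals of
the splitting are represented by vectors $u_i$ since the form reaches every functional. -/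
lemma exists_isFrame [Module.Finite A D] [Module.Projective A D] (k : SesqForm A D)
    (hk : Function.Surjective k) : ∃ (N : ℕ) (u e : Fin N → D), IsFrame k u e := by
  obtain ⟨N, f, hf⟩ := Module.Finite.exists_fin' A D
  obtain ⟨g, hg⟩ := Module.projective_lifting_property f LinearMap.id hf
  choose u hu using fun i : Fin N => hk (LinearMap.proj i ∘ₗ g)
  refine ⟨N, u, fun i => f (Pi.single i 1), fun ξ => ?_⟩
  simp only [hu, LinearMap.comp_apply, LinearMap.proj_apply, ← map_smul, ← map_sum]
  have : ∑ i, g ξ i • (Pi.single i 1 : Fin N → A) = g ξ := by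
    ext j
    simp [Finset.sum_apply, Pi.single_apply]
  rw [this]
  exact LinearMap.congr_fun hg ξ

variable {k : SesqForm A D} {u e : ι → D}

/-- A functional $\varphi$ is represented by $\sum_i \overline{\varphi(e_i)}\, u_i$, the conjugate
being forced by conjugate-linearity in the first variable. Thus a frame alone makes every functional
a bra, also after base change. -/
lemma IsFrame.surjective (hf : IsFrame k u e) : Function.Surjective k := by
  intro φ
  refine ⟨∑ i, star (φ (e i)) • u i, LinearMap.ext fun ξ => ?_⟩
  conv_rhs => rw [← hf ξ, map_sum]
  simp [LinearMap.sum_apply, mul_comm, starRingEnd_apply]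

lemma IsFrame.eq_of_forall (hf : IsFrame k u e) {ξ ζ : D} (h : ∀ τ, k τ ξ = k τ ζ) : ξ = ζ := by
  rw [← hf ξ, ← hf ζ]
  simp only [h]

lemma IsFrame.injective (hf : IsFrame k u e) (hs : ∀ ξ ζ, star (k ξ ζ) = k ζ ξ) :
    Function.Injective k := fun ξ ζ h =>
  hf.eq_of_forall fun τ => by rw [← hs ξ, ← hs ζ, h]

lemma IsFrame.apply_eq (hf : IsFrame k u e) {P : Type*} [AddCommGroup P] [Module A P]
    (T : D →ₗ[A] P) (ξ : D) : T ξ = ∑ i, k (u i) ξ • T (e i) := by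
  conv_lhs => rw [← hf ξ, map_sum]
  simp only [map_smul]

end Frame

/-! ### Base change of frames, hermitian forms and endomorphism algebras -/

section FrameBaseChange
variable {R S E ι : Type*} [CommRing R] [CommRing S] [Algebra R S] [StarRing R] [StarRing S]
  [AddCommGroup E] [Module R E] [Fintype ι] {k : SesqForm R E} {u e : ι → E}

lemma IsFrame.baseChange (hs : ∀ r : R, algebraMap R S (star r) = star (algebraMap R S r))
    (hf : IsFrame k u e) :
    IsFrame (formBaseChange hs k) (fun i => (1 : S) ⊗ₜ[R] u i) (fun i => (1 : S) ⊗ₜ[R] e i) := by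
  intro ξ
  induction ξ with
  | zero => simp
  | add x y hx hy =>
    simp only [map_add, add_smul, Finset.sum_add_distrib, hx, hy]
  | tmul g t =>
    conv_rhs => rw [← hf t, TensorProduct.tmul_sum]
    refine Finset.sum_congr rfl fun i _ => ?_
    rw [formBaseChange_tmul, star_one, one_mul, ← TensorProduct.smul_tmul,
      TensorProduct.smul_tmul', smul_eq_mul, mul_one, Algebra.smul_def]

lemma formBaseChange_symm (hs : ∀ r : R, algebraMap R S (star r) = star (algebraMap R S r))
    (hk : ∀ s t, star (k s t) = k t s) (ξ ζ : S ⊗[R] E) :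
    star (formBaseChange hs k ξ ζ) = formBaseChange hs k ζ ξ := by
  induction ξ with
  | zero => simp
  | add x y hx hy => simp only [map_add, LinearMap.add_apply, star_add, hx, hy]
  | tmul f s =>
    induction ζ with
    | zero => simp
    | add x y hx hy => simp only [map_add, LinearMap.add_apply, star_add, hx, hy]
    | tmul g t =>
      simp only [formBaseChange_tmul, star_mul, star_star, ← hs, hk]
      ring

/-- Endomorphisms of a finitely generated projective module commute with base change. -/
lemma IsFrame.tensorProductEnd_bijective
    (hs : ∀ r : R, algebraMap R S (star r) = star (algebraMap R S r)) (hf : IsFrame k u e) :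
    Function.Bijective (LinearMap.tensorProductEnd R S E) := by
  let kS := formBaseChange (S := S) hs k
  have hfS : IsFrame kS _ _ := hf.baseChange (S := S) hs
  -- The candidate inverse writes $T$ as the matrix $\langle u_j, T e_i\rangle$ with respect to the
  -- rank-one operators $|e_j\rangle\langle u_i|$, which are already defined over $R$.
  let G : Module.End S (S ⊗[R] E) → S ⊗[R] Module.End R E := fun T =>
    ∑ i, ∑ j, kS (1 ⊗ₜ u j) (T (1 ⊗ₜ e i)) ⊗ₜ[R] (k (u i)).smulRight (e j)
  have htmul : ∀ (a : S) (T : Module.End R E),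
      LinearMap.tensorProductEnd R S E (a ⊗ₜ T) = a • T.baseChange S := fun a T => rfl
  constructor
  · refine Function.LeftInverse.injective (g := G) fun z => ?_
    have hadd : ∀ T T', G (T + T') = G T + G T' := fun T T' => by
      simp only [G, LinearMap.add_apply, map_add, TensorProduct.add_tmul, Finset.sum_add_distrib]
    induction z with
    | zero => simp [G]
    | add x y hx hy => rw [map_add, hadd, hx, hy]
    | tmul a T =>
      -- The same matrix expansion over $R$; its coefficients can be moved across the tensor sign
      -- into $S$.
      have hT : T = ∑ i, ∑ j, k (u j) (T (e i)) • (k (u i)).smulRight (e j) := by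
        refine LinearMap.ext fun s => ?_
        rw [hf.apply_eq T s, LinearMap.sum_apply]
        refine Finset.sum_congr rfl fun i _ => ?_
        rw [LinearMap.sum_apply]
        conv_lhs => rw [← hf (T (e i)), Finset.smul_sum]
        refine Finset.sum_congr rfl fun j _ => ?_
        rw [LinearMap.smul_apply, LinearMap.smulRight_apply, smul_comm]
      conv_rhs => rw [hT, TensorProduct.tmul_sum]
      refine Finset.sum_congr rfl fun i _ => ?_
      rw [TensorProduct.tmul_sum]
      refine Finset.sum_congr rfl fun j _ => ?_
      rw [htmul, LinearMap.smul_apply, LinearMap.baseChange_tmul, TensorProduct.smul_tmul',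
        formBaseChange_tmul, ← TensorProduct.smul_tmul, Algebra.smul_def]
      simp [Algebra.smul_def]
  · refine fun T => ⟨G T, LinearMap.ext fun ξ => ?_⟩
    rw [hfS.apply_eq T ξ, map_sum, LinearMap.sum_apply]
    refine Finset.sum_congr rfl fun i _ => ?_
    rw [map_sum, LinearMap.sum_apply]
    conv_rhs => rw [← hfS (T (1 ⊗ₜ e i)), Finset.smul_sum]
    refine Finset.sum_congr rfl fun j _ => ?_
    rw [htmul, LinearMap.smul_apply, smul_comm]
    -- What remains is that the base change of $|e_j\rangle\langle u_i|$ is the rank-one operator of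
    -- the pulled-back frame.
    congr 1
    induction ξ with
    | zero => simp
    | add x y hx hy => simp only [map_add, add_smul, hx, hy]
    | tmul f s =>
      rw [LinearMap.baseChange_tmul, formBaseChange_tmul, LinearMap.smulRight_apply,
        ← TensorProduct.smul_tmul, TensorProduct.smul_tmul', Algebra.smul_def]
      simp

end FrameBaseChange

/-! ### Morita equivalence between modules over $A$ and over $S = \mathrm{End}_A(D)$ -/

section Morita
variable {A S D E ι : Type*} [CommRing A] [StarRing A] [Ring S] [Algebra A S]
  [AddCommGroup D] [Module A D] [AddCommGroup E] [Module A E] [Fintype ι]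
  {r : S →ₐ[A] Module.End A D} {c : S →ₐ[A] Module.End A E}

/-- The dual module `D^*` of an `S`-module `D`, tensored over `S` with the `S`-module `E`. -/
abbrev DualTensor (r : S →ₐ[A] Module.End A D) (c : S →ₐ[A] Module.End A E) :=
  BalTensor (fun x => transpose (r x)) (fun x => c x)

/-- The class of `φ ⊗ s`. -/
abbrev DualTensor.tmul (r : S →ₐ[A] Module.End A D) (c : S →ₐ[A] Module.End A E)
    (φ : Module.Dual A D) (s : E) : DualTensor r c :=
  BalTensor.tmul (fun x => transpose (r x)) (fun x => c x) φ s

lemma DualTensor.balanced (x : S) (φ : Module.Dual A D) (s : E) :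
    DualTensor.tmul r c (φ ∘ₗ r x) s = DualTensor.tmul r c φ (c x s) :=
  (Submodule.Quotient.eq _).2 (Submodule.subset_span ⟨φ, x, s, rfl⟩)

@[elab_as_elim]
lemma DualTensor.induction {p : DualTensor r c → Prop} (η : DualTensor r c) (zero : p 0)
    (add : ∀ x y, p x → p y → p (x + y)) (tmul : ∀ φ s, p (DualTensor.tmul r c φ s)) : p η := by
  obtain ⟨z, rfl⟩ := Submodule.mkQ_surjective _ η
  induction z with
  | zero => rw [map_zero]; exact zero
  | add x y hx hy => rw [map_add]; exact add _ _ hx hy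
  | tmul φ s => exact tmul φ s

/-- The action on `E` of the element of `S` that acts on `D` as `ζ ↦ φ(ζ) ξ`. -/
def rankOneAct (hr : Function.Bijective r) (c : S →ₐ[A] Module.End A E) :
    D →ₗ[A] Module.Dual A D →ₗ[A] Module.End A E :=
  LinearMap.mk₂ A (fun ξ φ => c ((AlgEquiv.ofBijective r hr).symm (φ.smulRight ξ)))
    (fun ξ ζ φ => by
      rw [← map_add, ← map_add]; congr 2; ext; simp)
    (fun a ξ φ => by
      rw [← map_smul, ← map_smul]; congr 2; ext; exact smul_comm _ _ _)
    (fun ξ φ ψ => by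
      rw [← map_add, ← map_add]; congr 2; ext; simp [add_smul])
    (fun a ξ φ => by
      rw [← map_smul, ← map_smul]; congr 2; ext; simp [mul_smul])

/-- Any preimage of the rank-one operator may be used, so later arguments choose one and never
manipulate the inverse of `r`. -/
lemma rankOneAct_eq (hr : Function.Bijective r) {ξ : D} {φ : Module.Dual A D} {x : S}
    (hx : r x = φ.smulRight ξ) : rankOneAct hr c ξ φ = c x := by
  change c ((AlgEquiv.ofBijective r hr).symm (φ.smulRight ξ)) = _
  rw [← hx]
  exact congrArg c ((AlgEquiv.ofBijective r hr).symm_apply_apply x)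

/-- Since $|\xi\rangle(\varphi\circ r(x)) = |\xi\rangle\varphi \cdot r(x)$, a preimage $y$ of
$|\xi\rangle\varphi$ gives the preimage $yx$. This is what lets the pairing descend to the balanced
tensor product. -/
lemma rankOneAct_comp (hr : Function.Bijective r) (ξ : D) (φ : Module.Dual A D) (x : S) :
    rankOneAct hr c ξ (φ ∘ₗ r x) = rankOneAct hr c ξ φ * c x := by
  obtain ⟨y, hy⟩ := hr.2 (φ.smulRight ξ)
  rw [rankOneAct_eq hr hy, rankOneAct_eq hr (x := y * x), map_mul]
  rw [map_mul, hy]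
  rfl

lemma rankOneAct_apply (hr : Function.Bijective r) (ξ : D) (φ : Module.Dual A D) (x : S) :
    rankOneAct hr c (r x ξ) φ = c x * rankOneAct hr c ξ φ := by
  obtain ⟨y, hy⟩ := hr.2 (φ.smulRight ξ)
  rw [rankOneAct_eq hr hy, rankOneAct_eq hr (x := x * y), map_mul]
  rw [map_mul, hy]
  ext; simp

/-- The pairing `ξ, φ ⊗ s ↦ c(r⁻¹(|ξ⟩φ)) s`. -/
def contract (hr : Function.Bijective r) (c : S →ₐ[A] Module.End A E) :
    D →ₗ[A] DualTensor r c →ₗ[A] E where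
  toFun ξ := (balRel _ _).liftQ (TensorProduct.lift (rankOneAct hr c ξ)) (by
    rw [balRel, Submodule.span_le]
    rintro _ ⟨φ, x, s, rfl⟩
    simp only [SetLike.mem_coe, LinearMap.mem_ker, map_sub, TensorProduct.lift.tmul,
      transpose_apply, rankOneAct_comp]
    exact sub_self _)
  map_add' ξ ζ := BalTensor.hom_ext fun φ s => by
    change rankOneAct hr c (ξ + ζ) φ s = rankOneAct hr c ξ φ s + rankOneAct hr c ζ φ s
    simp
  map_smul' a ξ := BalTensor.hom_ext fun φ s => by
    change rankOneAct hr c (a • ξ) φ s = a • rankOneAct hr c ξ φ s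
    simp

lemma contract_tmul (hr : Function.Bijective r) (ξ : D) (φ : Module.Dual A D) (s : E) :
    contract hr c ξ (DualTensor.tmul r c φ s) = rankOneAct hr c ξ φ s := rfl

lemma contract_apply (hr : Function.Bijective r) (x : S) (ξ : D) (η : DualTensor r c) :
    contract hr c (r x ξ) η = c x (contract hr c ξ η) := by
  induction η using DualTensor.induction with
  | zero => simp
  | add x y hx hy => simp only [map_add, hx, hy]
  | tmul φ s => rw [contract_tmul, contract_tmul, rankOneAct_apply]; rfl

/-- Twisting by an involution `γ` of `D` and an operator `β` on `E` that induce the same map `σ`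
on `S`. -/
lemma contract_twist (hr : Function.Bijective r) {γ : Module.End A D} (hγ : γ * γ = 1)
    {β : Module.End A E} {σ : S → S} (hσ : ∀ x, r x * γ = γ * r (σ x))
    (hβ : ∀ x, β * c x = c (σ x) * β) {β' : Module.End A (DualTensor r c)}
    (hβ' : ∀ φ s, β' (DualTensor.tmul r c φ s) = DualTensor.tmul r c (φ ∘ₗ γ) (β s))
    (ξ : D) (η : DualTensor r c) :
    contract hr c (γ ξ) (β' η) = β (contract hr c ξ η) := by
  induction η using DualTensor.induction with
  | zero => simp
  | add x y hx hy => simp only [map_add, hx, hy]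
  | tmul φ s =>
    obtain ⟨x, hx⟩ := hr.2 (φ.smulRight ξ)
    -- Because $\gamma^2 = 1$, the hypothesis says $r(\sigma x) = \gamma\, r(x)\, \gamma$, and
    -- conjugating $|\xi\rangle\varphi$ by $\gamma$ gives $|\gamma\xi\rangle(\varphi\circ\gamma)$.
    have h1 : r (σ x) = (φ ∘ₗ γ).smulRight (γ ξ) := by
      have h2 := congrArg (γ * ·) (hσ x)
      simp only [← mul_assoc, hγ, one_mul] at h2
      rw [← h2, hx]
      refine LinearMap.ext fun ζ => ?_
      simp only [Module.End.mul_apply, LinearMap.smulRight_apply, map_smul, LinearMap.comp_apply]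
    rw [hβ', contract_tmul, contract_tmul, rankOneAct_eq _ h1, rankOneAct_eq _ hx]
    exact (LinearMap.congr_fun (hβ x) s).symm

variable {k : SesqForm A D} {u e : ι → D} (hf : IsFrame k u e)
include hf

/-- This is one half of the inversion of `contract`. For $\eta = \varphi \otimes s$ and $r(x) =
|\xi\rangle\varphi$, move $x$ across the balanced tensor sign: $\langle u_i|\circ r(x) = \langle
u_i, \xi\rangle\varphi$. The scalar then moves to $e_i$, and the frame identity sums the first
factors to $\xi$. -/
lemma IsFrame.sum_tmul_contract (hr : Function.Bijective r) (ξ : D) (η : DualTensor r c) :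
    ∑ i, e i ⊗ₜ[A] DualTensor.tmul r c (k (u i)) (contract hr c ξ η) = ξ ⊗ₜ η := by
  induction η using DualTensor.induction with
  | zero => simp [BalTensor.tmul]
  | add x y hx hy =>
    rw [TensorProduct.tmul_add, ← hx, ← hy, ← Finset.sum_add_distrib]
    simp only [map_add, BalTensor.tmul, TensorProduct.tmul_add]
  | tmul φ s =>
    obtain ⟨x, hx⟩ := hr.2 (φ.smulRight ξ)
    rw [contract_tmul, rankOneAct_eq hr hx]
    conv_rhs => rw [← hf ξ, TensorProduct.sum_tmul]
    refine Finset.sum_congr rfl fun i _ => ?_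
    rw [← DualTensor.balanced, hx, TensorProduct.smul_tmul]
    congr 1
    have : k (u i) ∘ₗ φ.smulRight ξ = k (u i) ξ • φ := by
      ext ζ; simp [mul_comm]
    rw [this]
    simp only [DualTensor.tmul, BalTensor.tmul, ← TensorProduct.smul_tmul', map_smul]

/-- This is the other half. The frame identity reads $\sum_i |e_i\rangle\langle u_i| = 1$ in
$\mathrm{End}(D)$, so the preimages of these operators sum to $1$ in $S$ by injectivity of `r`. -/
lemma IsFrame.sum_contract (hr : Function.Bijective r) (s : E) :
    ∑ i, contract hr c (e i) (DualTensor.tmul r c (k (u i)) s) = s := by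
  have hx : ∀ i, ∃ x, r x = (k (u i)).smulRight (e i) := fun i => hr.2 _
  choose x hx using hx
  have h1 : ∑ i, x i = 1 := hr.1 (by
    rw [map_sum, map_one]
    refine LinearMap.ext fun ζ => ?_
    simp only [LinearMap.sum_apply, hx, LinearMap.smulRight_apply, Module.End.one_apply]
    exact hf ζ)
  calc _ = ∑ i, c (x i) s := Finset.sum_congr rfl fun i _ => by
        rw [contract_tmul, rankOneAct_eq hr (hx i)]
    _ = c (∑ i, x i) s := by rw [map_sum, LinearMap.sum_apply]
    _ = s := by rw [h1, map_one, Module.End.one_apply]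

/-- The isomorphism `D ⊗ (D^* ⊗_S E) ≅ E` for `S = End(D)`. -/
def IsFrame.contractEquiv (hr : Function.Bijective r) (c : S →ₐ[A] Module.End A E) :
    D ⊗[A] DualTensor r c ≃ₗ[A] E where
  toLinearMap := TensorProduct.lift (contract hr c)
  invFun s := ∑ i, e i ⊗ₜ DualTensor.tmul r c (k (u i)) s
  left_inv z := by
    have hadd : ∀ s t : E, ∑ i, e i ⊗ₜ[A] DualTensor.tmul r c (k (u i)) (s + t) =
        ∑ i, e i ⊗ₜ[A] DualTensor.tmul r c (k (u i)) s +
        ∑ i, e i ⊗ₜ[A] DualTensor.tmul r c (k (u i)) t := fun s t => by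
      rw [← Finset.sum_add_distrib]
      simp only [BalTensor.tmul, TensorProduct.tmul_add, map_add]
    induction z with
    | zero => simp [BalTensor.tmul]
    | add x y hx hy =>
      simp only [AddHom.toFun_eq_coe, LinearMap.coe_toAddHom, map_add] at hx hy ⊢
      rw [hadd, hx, hy]
    | tmul ξ η => exact hf.sum_tmul_contract hr ξ η
  right_inv s := by
    simp only [AddHom.toFun_eq_coe, LinearMap.coe_toAddHom, map_sum, TensorProduct.lift.tmul]
    exact hf.sum_contract hr s

-- A frame makes every functional a bra, so statements about $D^* \otimes_S E$ need checking only
-- where the form is prescribed.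
@[elab_as_elim]
lemma IsFrame.dualTensor_induction {p : DualTensor r c → Prop} (η : DualTensor r c) (zero : p 0)
    (add : ∀ x y, p x → p y → p (x + y)) (tmul : ∀ ξ s, p (DualTensor.tmul r c (k ξ) s)) :
    p η := by
  refine DualTensor.induction η zero add fun φ s => ?_
  obtain ⟨ξ, rfl⟩ := hf.surjective φ
  exact tmul ξ s

variable (hs : ∀ ξ ζ, star (k ξ ζ) = k ζ ξ) {l : SesqForm A E} (ls : ∀ s t, star (l s t) = l t s)
  (hadj : ∀ x : S, ∃ y : S, (∀ ξ ζ, k (r x ξ) ζ = k ξ (r y ζ)) ∧ ∀ s t, l (c x s) t = l s (c y t))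
include hs

/-- The identity $(|\xi\rangle\langle\zeta|)^* = |\zeta\rangle\langle\xi|$ holds by nondegeneracy.
Adjoints are given element by element, without a chosen involution on $S$, so this is how the
adjoint of a rank-one preimage is recognised. -/
lemma IsFrame.adjoint_ketBra {x y : S} {ξ ζ : D}
    (hx : r x = (k ζ).smulRight ξ) (hy : ∀ ξ ζ, k (r x ξ) ζ = k ξ (r y ζ)) :
    r y = (k ξ).smulRight ζ := by
  refine LinearMap.ext fun τ => hf.eq_of_forall fun σ => ?_
  rw [← hy, hx]
  simp only [LinearMap.smulRight_apply, map_smulₛₗ, LinearMap.smul_apply, starRingEnd_apply, hs,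
    smul_eq_mul, RingHom.id_apply]
  exact mul_comm _ _

include hadj

/-- The form on `D^* ⊗_S E` with `⟨⟨ξ₁| ⊗ s₁, ⟨ξ₂| ⊗ s₂⟩ = ⟨s₁, c(r⁻¹(|ξ₁⟩⟨ξ₂|)) s₂⟩`. -/
theorem IsFrame.exists_dualForm (hr : Function.Bijective r) :
    ∃ h : SesqForm A (DualTensor r c), ∀ ξ s η,
      h (DualTensor.tmul r c (k ξ) s) η = l s (contract hr c ξ η) := by
  -- The form is prescribed on bras but has to be defined on all functionals; the inverse of $\xi
  -- \mapsto \langle\xi|$ is conjugate-linear, as the first variable requires.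
  let kE : D ≃ₛₗ[starRingEnd A] Module.Dual A D :=
    LinearEquiv.ofBijective k ⟨hf.injective hs, hf.surjective⟩
  have hkE : ∀ φ, k (kE.symm φ) = φ := kE.apply_symm_apply
  have hkE' : ∀ ξ, kE.symm (k ξ) = ξ := kE.symm_apply_apply
  let F : Module.Dual A D ⊗[A] E →ₗ⋆[A] Module.Dual A (DualTensor r c) :=
    TensorProduct.lift (LinearMap.mk₂'ₛₗ (starRingEnd A) (starRingEnd A)
      (fun φ s => l s ∘ₗ contract hr c (kE.symm φ))
      (by intros; ext; simp) (by intros; ext; simp [map_smulₛₗ kE.symm])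
      (by intros; ext; simp) (by intros; ext; simp))
  refine ⟨(balRel _ _).liftQ F ?_, fun ξ s η => ?_⟩
  · refine Submodule.span_le.2 ?_
    rintro _ ⟨φ, x, s, rfl⟩
    obtain ⟨y, hy1, hy2⟩ := hadj x
    rw [SetLike.mem_coe, LinearMap.mem_ker, map_sub, sub_eq_zero]
    refine LinearMap.ext fun η => ?_
    change l s (contract hr c (kE.symm (transpose (r x) φ)) η) =
      l (c x s) (contract hr c (kE.symm φ) η)
    -- Precomposing a functional with $r(x)$ corresponds to applying the adjoint $r(y)$ to its
    -- vector. The same $y$ is adjoint to $x$ on $E$, so the two sides of the balancing relation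
    -- agree.
    have : kE.symm (transpose (r x) φ) = r y (kE.symm φ) := by
      refine hf.injective hs (LinearMap.ext fun ζ => ?_)
      rw [hkE, ← hs, ← hy1, hs, hkE]
      rfl
    rw [this, contract_apply, hy2]
  · change l s (contract hr c (kE.symm (k ξ)) η) = _
    rw [hkE']

include ls

/-- On bras the two values are $\langle s_1, c(x)s_2\rangle$ and $\langle s_2, c(y)s_1\rangle$ with
$x$, $y$ over $|\xi_1\rangle\langle\xi_2|$, $|\xi_2\rangle\langle\xi_1|$. The adjoint of $x$ is such
a $y$. -/
lemma IsFrame.dualForm_symm (hr : Function.Bijective r) {h : SesqForm A (DualTensor r c)}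
    (hh : ∀ ξ s η, h (DualTensor.tmul r c (k ξ) s) η = l s (contract hr c ξ η))
    (η₁ η₂ : DualTensor r c) : star (h η₁ η₂) = h η₂ η₁ := by
  induction η₁ using hf.dualTensor_induction with
  | zero => simp
  | add x y hx hy => simp only [map_add, LinearMap.add_apply, star_add, hx, hy]
  | tmul ξ₁ s₁ =>
    induction η₂ using hf.dualTensor_induction with
    | zero => simp
    | add x y hx hy => simp only [map_add, LinearMap.add_apply, star_add, hx, hy]
    | tmul ξ₂ s₂ =>
      obtain ⟨x, hx⟩ := hr.2 ((k ξ₂).smulRight ξ₁)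
      obtain ⟨y, hy1, hy2⟩ := hadj x
      rw [hh, hh, contract_tmul, contract_tmul, rankOneAct_eq hr hx,
        rankOneAct_eq hr (hf.adjoint_ketBra hs hx hy1), ls, hy2]

omit ls

/-- Take $\eta_1 = \langle\zeta| \otimes s$ and move $c(x)$, with $x$ over
$|\xi_1\rangle\langle\zeta|$, to the other side as its adjoint. That adjoint sends $\xi_2$ to
$\zeta\langle\xi_1, \xi_2\rangle$, so the scalar comes out and the definition of the form is left.
-/
lemma IsFrame.contract_form (hr : Function.Bijective r) {h : SesqForm A (DualTensor r c)}
    (hh : ∀ ξ s η, h (DualTensor.tmul r c (k ξ) s) η = l s (contract hr c ξ η))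
    (ξ₁ ξ₂ : D) (η₁ η₂ : DualTensor r c) :
    l (contract hr c ξ₁ η₁) (contract hr c ξ₂ η₂) = h η₁ η₂ * k ξ₁ ξ₂ := by
  induction η₁ using hf.dualTensor_induction with
  | zero => simp
  | add x y hx hy => simp only [map_add, LinearMap.add_apply, add_mul, hx, hy]
  | tmul ζ s =>
    obtain ⟨x, hx⟩ := hr.2 ((k ζ).smulRight ξ₁)
    obtain ⟨y, hy1, hy2⟩ := hadj x
    have hy := hf.adjoint_ketBra hs hx hy1
    rw [hh, contract_tmul, rankOneAct_eq hr hx, hy2, ← contract_apply, hy,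
      LinearMap.smulRight_apply, map_smul, LinearMap.smul_apply, map_smul, smul_eq_mul, mul_comm]

lemma IsFrame.contractEquiv_form (hr : Function.Bijective r) {h : SesqForm A (DualTensor r c)}
    (hh : ∀ ξ s η, h (DualTensor.tmul r c (k ξ) s) η = l s (contract hr c ξ η))
    (a b : D ⊗[A] DualTensor r c) :
    l (hf.contractEquiv hr c a) (hf.contractEquiv hr c b) = formTensor k h a b := by
  induction a with
  | zero => simp
  | add x y hx hy => simp only [map_add, LinearMap.add_apply, hx, hy]
  | tmul ξ₁ η₁ =>
    induction b with
    | zero => simp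
    | add x y hx hy => simp only [map_add, hx, hy]
    | tmul ξ₂ η₂ =>
      rw [formTensor_tmul]
      exact hf.contract_form hs hadj hr hh ξ₁ ξ₂ η₁ η₂

omit hs hadj

lemma IsFrame.dualForm_ext {h h' : SesqForm A (DualTensor r c)}
    (H : ∀ ξ₁ s₁ ξ₂ s₂, h (DualTensor.tmul r c (k ξ₁) s₁) (DualTensor.tmul r c (k ξ₂) s₂) =
      h' (DualTensor.tmul r c (k ξ₁) s₁) (DualTensor.tmul r c (k ξ₂) s₂)) : h = h' := by
  refine LinearMap.ext fun η₁ => LinearMap.ext fun η₂ => ?_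
  induction η₁ using hf.dualTensor_induction with
  | zero => simp
  | add x y hx hy => simp only [map_add, LinearMap.add_apply, hx, hy]
  | tmul ξ₁ s₁ =>
    induction η₂ using hf.dualTensor_induction with
    | zero => simp
    | add x y hx hy => simp only [map_add, hx, hy]
    | tmul ξ₂ s₂ => exact H ξ₁ s₁ ξ₂ s₂

include hs ls hadj

/-- The hermitian form on `D^* ⊗_S E` and the isometry `D ⊗ (D^* ⊗_S E) ≅ E`, for `S = End(D)`. -/
theorem IsFrame.exists_isometry (hr : Function.Bijective r) :
    ∃ h : SesqForm A (DualTensor r c),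
      (∀ ξ₁ ξ₂ s₁ s₂ x, r x = (k ξ₂).smulRight ξ₁ →
        h (DualTensor.tmul r c (k ξ₁) s₁) (DualTensor.tmul r c (k ξ₂) s₂) = l s₁ (c x s₂)) ∧
      (∀ η₁ η₂, star (h η₁ η₂) = h η₂ η₁) ∧
    ∃ Φ : D ⊗[A] DualTensor r c ≃ₗ[A] E,
      (∀ a b, l (Φ a) (Φ b) = formTensor k h a b) ∧ ∀ ξ η, Φ (ξ ⊗ₜ η) = contract hr c ξ η := by
  obtain ⟨h, hh⟩ := hf.exists_dualForm hs hadj hr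
  refine ⟨h, fun ξ₁ ξ₂ s₁ s₂ x hx => ?_, hf.dualForm_symm hs ls hadj hr hh,
    hf.contractEquiv hr c, hf.contractEquiv_form hs hadj hr hh, fun _ _ => rfl⟩
  rw [hh, contract_tmul, rankOneAct_eq hr hx]

end Morita

/-! ### Graded tensor products of Clifford algebras and their actions -/

section GradedClifford
variable {A X : Type*} [CommRing A] [AddCommGroup X] [Module A X] {Q : QuadraticForm A X}
  {p q : Submodule A X}

@[elab_as_elim]
lemma subCl_induction {P : subCl Q p → Prop} (x : subCl Q p)
    (algebraMap : ∀ a, P (algebraMap A _ a)) (ι : ∀ v, P (subι Q p v))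
    (add : ∀ a b, P a → P b → P (a + b)) (mul : ∀ a b, P a → P b → P (a * b)) : P x := by
  obtain ⟨x, hx⟩ := x
  induction hx using Algebra.adjoin_induction with
  | mem x hx =>
    obtain ⟨z, hz, rfl⟩ := hx
    exact ι ⟨z, hz⟩
  | algebraMap r => exact algebraMap r
  | add a b ha hb h1 h2 => exact add ⟨a, ha⟩ ⟨b, hb⟩ h1 h2
  | mul a b ha hb h1 h2 => exact mul ⟨a, ha⟩ ⟨b, hb⟩ h1 h2

lemma subInvolute_of_mem_zero {x : subCl Q p} (hx : x ∈ subGr Q p 0) : subInvolute Q p x = x :=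
  Subtype.ext (CliffordAlgebra.involute_eq_of_mem_even hx)

lemma subInvolute_of_mem_one {x : subCl Q p} (hx : x ∈ subGr Q p 1) : subInvolute Q p x = -x :=
  Subtype.ext (CliffordAlgebra.involute_eq_of_mem_odd hx)

lemma subι_mem_subGr (v : p) : subι Q p v ∈ subGr Q p 1 :=
  CliffordAlgebra.ι_mem_evenOdd_one Q (v : X)

lemma zmod_two_eq (i : ZMod 2) : i = 0 ∨ i = 1 := by
  revert i; decide

/-- Algebra homomorphisms that anticommute on generators commute up to the sign of the degrees. -/
lemma graded_commute {C : Type*} [Ring C] [Algebra A C] {f : subCl Q p →ₐ[A] C}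
    {g : subCl Q q →ₐ[A] C}
    (h : ∀ v w, f (subι Q p v) * g (subι Q q w) + g (subι Q q w) * f (subι Q p v) = 0)
    ⦃i j : ZMod 2⦄ (a : subGr Q p i) (b : subGr Q q j) :
    f a * g b = (-1 : ℤˣ) ^ (j * i) • (g b * f a) := by
  obtain ⟨a, ha⟩ := a
  obtain ⟨b, hb⟩ := b
  have h1 : ∀ w, f a * g (subι Q q w) = g (subι Q q w) * f (subInvolute Q p a) := fun w =>
    subCl_conj f (g (subι Q q w)) (fun v => h v w) a
  change f a * g b = (-1 : ℤˣ) ^ (j * i) • (g b * f a)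
  obtain rfl | rfl := zmod_two_eq i
  · rw [subInvolute_of_mem_zero ha] at h1
    rw [mul_zero, uzpow_zero, one_smul]
    -- For even $a$ there is no sign whatever the degree of $b$; forgetting that degree allows
    -- induction over sums and products.
    clear hb
    induction b using subCl_induction with
    | algebraMap r => rw [AlgHom.commutes, Algebra.commutes]
    | ι w => exact h1 w
    | add x y hx hy => rw [map_add, mul_add, add_mul, hx, hy]
    | mul x y hx hy => rw [map_mul, ← mul_assoc, hx, mul_assoc, hy, mul_assoc]
  · rw [subInvolute_of_mem_one ha] at h1
    -- For odd $a$, $f(a)$ anticommutes with every generator's image under `g`, so `subCl_conj`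
    -- applies again with $f(a)$ as the anticommuting element.
    have h2 := subCl_conj g (f a) (fun w => by rw [h1, map_neg, mul_neg, add_neg_cancel]) b
    obtain rfl | rfl := zmod_two_eq j
    · rw [subInvolute_of_mem_zero hb] at h2
      rw [zero_mul, uzpow_zero, one_smul, h2]
    · rw [subInvolute_of_mem_one hb, map_neg, mul_neg] at h2
      rw [mul_one, uzpow_one, Units.neg_smul, one_smul, h2, neg_neg]

variable [Invertible (2 : A)]

/-- Odd elements of the two factors anticommute, so the cross terms cancel. This is the Clifford
relation needed to map the whole Clifford algebra into the graded tensor product. -/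
lemma sq_add_tmul (v : p) (w : q) :
    (GradedTensorProduct.includeLeft (subGr Q p) (subGr Q q) (subι Q p v) +
      GradedTensorProduct.includeRight (subGr Q p) (subGr Q q) (subι Q q w)) *
    (GradedTensorProduct.includeLeft (subGr Q p) (subGr Q q) (subι Q p v) +
      GradedTensorProduct.includeRight (subGr Q p) (subGr Q q) (subι Q q w)) =
    algebraMap A _ (Q v + Q w) := by
  have hsq : ∀ (p : Submodule A X) (v : p), subι Q p v * subι Q p v = algebraMap A _ (Q v) :=
    fun p v => Subtype.ext (CliffordAlgebra.ι_sq_scalar Q (v : X))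
  have hcomm : GradedTensorProduct.includeRight (subGr Q p) (subGr Q q) (subι Q q w) *
      GradedTensorProduct.includeLeft (subGr Q p) (subGr Q q) (subι Q p v) =
      -(GradedTensorProduct.includeLeft (subGr Q p) (subGr Q q) (subι Q p v) *
        GradedTensorProduct.includeRight (subGr Q p) (subGr Q q) (subι Q q w)) := by
    have h1 := GradedTensorProduct.tmul_coe_mul_coe_tmul (R := A) (subGr Q p) (subGr Q q) 1
      (⟨subι Q q w, subι_mem_subGr w⟩ : subGr Q q 1) (⟨subι Q p v, subι_mem_subGr v⟩ : subGr Q p 1) 1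
    have h2 := GradedTensorProduct.tmul_one_mul_one_tmul (R := A) (subGr Q p) (subGr Q q)
      (subι Q p v) (subι Q q w)
    rw [mul_one, uzpow_one, Units.neg_smul, one_smul, one_mul, mul_one] at h1
    exact h1.trans (congrArg Neg.neg h2.symm)
  have hL := map_mul (GradedTensorProduct.includeLeft (R := A) (subGr Q p) (subGr Q q))
    (subι Q p v) (subι Q p v)
  have hR := map_mul (GradedTensorProduct.includeRight (R := A) (subGr Q p) (subGr Q q))
    (subι Q q w) (subι Q q w)
  rw [hsq, AlgHom.commutes] at hL hR
  rw [add_mul, mul_add, mul_add, hcomm, ← hL, ← hR, map_add]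
  abel

/-- Multiplication identifies the graded tensor product of the Clifford algebras of two orthogonal
summands with the whole Clifford algebra. -/
theorem exists_gradedEquiv (hpq : IsCompl p q) (ho : ∀ x ∈ p, ∀ y ∈ q, Q.IsOrtho x y) :
    ∃ Ψ : (subGr Q p) ᵍ⊗[A] (subGr Q q) ≃ₐ[A] CliffordAlgebra Q,
      ∀ (x : subCl Q p) (y : subCl Q q), Ψ (GradedTensorProduct.tmul A x y) =
        (x : CliffordAlgebra Q) * (y : CliffordAlgebra Q) := by
  let e := Submodule.prodEquivOfIsCompl p q hpq
  have he : ∀ v : X, ((e.symm v).1 : X) + (e.symm v).2 = v := fun v => e.apply_symm_apply v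
  have hQ : ∀ v : X, Q (e.symm v).1 + Q (e.symm v).2 = Q v := fun v => by
    conv_rhs => rw [← he v]
    exact (QuadraticMap.isOrtho_def.1 (ho _ (e.symm v).1.2 _ (e.symm v).2.2)).symm
  let F : (subGr Q p) ᵍ⊗[A] (subGr Q q) →ₐ[A] CliffordAlgebra Q :=
    GradedTensorProduct.lift _ _ (subCl Q p).val (subCl Q q).val (graded_commute fun v w => by
      change CliffordAlgebra.ι Q v * CliffordAlgebra.ι Q w +
        CliffordAlgebra.ι Q w * CliffordAlgebra.ι Q v = 0
      rw [CliffordAlgebra.ι_mul_ι_comm_of_isOrtho (ho v v.2 w w.2), neg_add_cancel])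
  have hF : ∀ (x : subCl Q p) (y : subCl Q q), F (GradedTensorProduct.tmul A x y) =
      (x : CliffordAlgebra Q) * (y : CliffordAlgebra Q) := fun x y => rfl
  let iL := GradedTensorProduct.includeLeft (R := A) (subGr Q p) (subGr Q q)
  let iR := GradedTensorProduct.includeRight (R := A) (subGr Q p) (subGr Q q)
  have hL : ∀ x, F (iL x) = x := fun x => (hF x 1).trans (mul_one _)
  have hR : ∀ y, F (iR y) = y := fun y => (hF 1 y).trans (one_mul _)
  -- The inverse of multiplication comes from the universal property: $v = v_p + v_q$ goes to $v_p
  -- \otimes 1 + 1 \otimes v_q$, and $Q$ is additive on the orthogonal components.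
  let G : CliffordAlgebra Q →ₐ[A] (subGr Q p) ᵍ⊗[A] (subGr Q q) :=
    CliffordAlgebra.lift Q ⟨(LinearMap.coprod (iL.toLinearMap ∘ₗ subι Q p)
      (iR.toLinearMap ∘ₗ subι Q q)) ∘ₗ e.symm.toLinearMap, fun v =>
        (sq_add_tmul (e.symm v).1 (e.symm v).2).trans (by rw [hQ])⟩
  have hG : ∀ v, G (CliffordAlgebra.ι Q v) =
      iL (subι Q p (e.symm v).1) + iR (subι Q q (e.symm v).2) := fun v =>
    CliffordAlgebra.lift_ι_apply _ _ _
  refine ⟨AlgEquiv.ofAlgHom F G ?_ ?_, hF⟩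
  · refine CliffordAlgebra.hom_ext (LinearMap.ext fun v => ?_)
    change F (G (CliffordAlgebra.ι Q v)) = CliffordAlgebra.ι Q v
    rw [hG, map_add, hL, hR, subι_coe, subι_coe, ← map_add, he]
  · refine GradedTensorProduct.algHom_ext _ _ (subCl_hom_ext fun v => ?_)
      (subCl_hom_ext fun w => ?_)
    · change G (F (iL (subι Q p v))) = iL (subι Q p v)
      have : e.symm v = (v, 0) := e.symm_apply_eq.2 (by simp [e])
      rw [hL, subι_coe, hG, this, map_zero, map_zero, add_zero]
    · change G (F (iR (subι Q q w))) = iR (subι Q q w)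
      have : e.symm w = (0, w) := e.symm_apply_eq.2 (by simp [e])
      rw [hR, subι_coe, hG, this, map_zero, map_zero, zero_add]

variable {D W : Type*} [AddCommGroup D] [Module A D] [AddCommGroup W] [Module A W]

/-- The algebra homomorphism `y ↦ γ^{deg y} ⊗ V(y)`, for an involution `γ`. -/
theorem exists_twist {γ : Module.End A D} (hγ : γ * γ = 1) (V : subCl Q q →ₐ[A] Module.End A W) :
    ∃ G : subCl Q q →ₐ[A] Module.End A (D ⊗[A] W), ∀ (j : ZMod 2) (y : subCl Q q),
      y ∈ subGr Q q j → G y = TensorProduct.map (γ ^ j.val) (V y) := by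
  -- `P` and `N` are the projections onto the $\pm 1$ eigenspaces of $\gamma$, so $\gamma^{\deg y}$
  -- is $P + (-1)^{\deg y} N$.
  let P : Module.End A D := (⅟2 : A) • (1 + γ)
  let N : Module.End A D := (⅟2 : A) • (1 - γ)
  have h2 : ∀ z : Module.End A D, (⅟2 : A) • (z + z) = z := fun z => by
    rw [← two_smul A z, smul_smul, invOf_mul_self, one_smul]
  have hPN : P + N = 1 := by
    simp only [P, N]; rw [← smul_add, add_add_sub_cancel, h2]
  have hPN' : P - N = γ := by
    simp only [P, N]; rw [← smul_sub, add_sub_sub_cancel, h2]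
  have hmul : P * N = 0 := by
    simp only [P, N, smul_mul_smul_comm, add_mul, mul_sub, one_mul, mul_one, hγ]
    rw [add_comm γ, sub_self, smul_zero]
  have hmul' : N * P = 0 := by
    simp only [P, N, smul_mul_smul_comm, sub_mul, mul_add, one_mul, mul_one, hγ]
    rw [sub_add_sub_cancel, sub_self, smul_zero]
  have hP : P * P = P := by
    conv_rhs => rw [← mul_one P, ← hPN, mul_add, hmul, add_zero]
  have hN : N * N = N := by
    conv_rhs => rw [← mul_one N, ← hPN, mul_add, hmul', zero_add]
  -- Placing the sign on $y$ through the grading automorphism gives a formula that needs no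
  -- homogeneous decomposition; orthogonality of the idempotents makes it multiplicative.
  let L : subCl Q q →ₗ[A] Module.End A (D ⊗[A] W) :=
    TensorProduct.mapBilinear (RingHom.id A) D W D W P ∘ₗ V.toLinearMap +
    TensorProduct.mapBilinear (RingHom.id A) D W D W N ∘ₗ V.toLinearMap ∘ₗ
      (subInvolute Q q).toLinearMap
  have hL : ∀ y, L y = TensorProduct.map P (V y) + TensorProduct.map N (V (subInvolute Q q y)) :=
    fun y => rfl
  refine ⟨AlgHom.ofLinearMap L ?_ ?_, fun j y hy => ?_⟩
  · rw [hL, map_one, map_one, map_one, ← TensorProduct.map_add_left, hPN]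
    exact TensorProduct.map_one
  · intro x y
    rw [hL, hL, hL, add_mul, mul_add, mul_add]
    simp only [← TensorProduct.map_mul, hP, hN, hmul, hmul', TensorProduct.map_zero_left, map_mul,
      add_zero, zero_add]
  · change L y = _
    rw [hL]
    obtain rfl | rfl := zmod_two_eq j
    · rw [subInvolute_of_mem_zero hy, ← TensorProduct.map_add_left, hPN]
      rfl
    · rw [subInvolute_of_mem_one hy, map_neg, show (1 : ZMod 2).val = 1 from rfl, pow_one, ← hPN',
        sub_eq_add_neg, TensorProduct.map_add_left]
      congr 1
      refine TensorProduct.ext' fun ξ η => ?_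
      simp [TensorProduct.tmul_neg, TensorProduct.neg_tmul]

/-- The action `(x ⊗ y)(ξ ⊗ η) = F(x) γ^{deg y} ξ ⊗ V(y) η` of a graded tensor product. -/
theorem exists_gradedAction {γ : Module.End A D} (hγ : γ * γ = 1)
    {F : subCl Q p →ₐ[A] Module.End A D}
    (hF : ∀ x, F x * γ = γ * F (subInvolute Q p x)) (V : subCl Q q →ₐ[A] Module.End A W) :
    ∃ ρ : (subGr Q p) ᵍ⊗[A] (subGr Q q) →ₐ[A] Module.End A (D ⊗[A] W),
      ∀ (j : ZMod 2) (x : subCl Q p) (y : subCl Q q), y ∈ subGr Q q j → ∀ (ξ : D) (η : W),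
        ρ (GradedTensorProduct.tmul A x y) (ξ ⊗ₜ η) = F x ((γ ^ j.val) ξ) ⊗ₜ V y η := by
  obtain ⟨G, hG⟩ := exists_twist hγ V
  let F' : subCl Q p →ₐ[A] Module.End A (D ⊗[A] W) := (Module.End.rTensorAlgHom A D W).comp F
  have hF' : ∀ x, F' x = TensorProduct.map (F x) 1 := fun x => rfl
  refine ⟨GradedTensorProduct.lift _ _ F' G (graded_commute fun v w => ?_), ?_⟩
  -- The generators act as $F(v) \otimes 1$ and $\gamma \otimes V(w)$; they anticommute because
  -- $F(v)$ anticommutes with $\gamma$. This is the reason for the factor $\gamma^{\deg y}$.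
  · rw [hF', hG 1 _ (subι_mem_subGr w), ← TensorProduct.map_mul, ← TensorProduct.map_mul,
      show (1 : ZMod 2).val = 1 from rfl, pow_one, hF, subInvolute_subι, map_neg, mul_one, one_mul,
      ← TensorProduct.map_add_left, mul_neg, neg_add_cancel, TensorProduct.map_zero_left]
  · intro j x y hy ξ η
    rw [GradedTensorProduct.lift_tmul, hF', hG j y hy]
    rfl

/-- An isomorphism `D ⊗ W ≅ E` that intertwines the generators intertwines the graded action. -/
theorem gradedAction_intertwine {E : Type*} [AddCommGroup E] [Module A E] {γ : Module.End A D}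
    {F : subCl Q p →ₐ[A] Module.End A D} {V : subCl Q q →ₐ[A] Module.End A W}
    {Ψ : (subGr Q p) ᵍ⊗[A] (subGr Q q) ≃ₐ[A] CliffordAlgebra Q}
    (hΨ : ∀ (x : subCl Q p) (y : subCl Q q), Ψ (GradedTensorProduct.tmul A x y) =
      (x : CliffordAlgebra Q) * (y : CliffordAlgebra Q))
    {ρ : (subGr Q p) ᵍ⊗[A] (subGr Q q) →ₐ[A] Module.End A (D ⊗[A] W)}
    (hρ : ∀ (j : ZMod 2) (x : subCl Q p) (y : subCl Q q), y ∈ subGr Q q j → ∀ (ξ : D) (η : W),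
      ρ (GradedTensorProduct.tmul A x y) (ξ ⊗ₜ η) = F x ((γ ^ j.val) ξ) ⊗ₜ V y η)
    (cl : CliffordAlgebra Q →ₐ[A] Module.End A E) (Φ : D ⊗[A] W ≃ₗ[A] E)
    (hL : ∀ (x : subCl Q p) ξ η, Φ (F x ξ ⊗ₜ η) = cl x (Φ (ξ ⊗ₜ η)))
    (hR : ∀ (w : q) ξ η, Φ (γ ξ ⊗ₜ V (subι Q q w) η) = cl (CliffordAlgebra.ι Q w) (Φ (ξ ⊗ₜ η)))
    (z : (subGr Q p) ᵍ⊗[A] (subGr Q q)) (a : D ⊗[A] W) : Φ (ρ z a) = cl (Ψ z) (Φ a) := by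
  -- Transported to $E$ along $\Phi$, both actions are algebra homomorphisms on the graded tensor
  -- product, so they are compared on $x \otimes 1$ and on $1 \otimes w$ with $w$ a generator.
  have key : (Φ.conjAlgEquiv A : Module.End A (D ⊗[A] W) →ₐ[A] Module.End A E).comp ρ =
      cl.comp (Ψ : _ →ₐ[A] CliffordAlgebra Q) := by
    refine GradedTensorProduct.algHom_ext _ _ (AlgHom.ext fun x => ?_) (subCl_hom_ext fun w => ?_)
    · refine LinearMap.ext fun s => ?_
      obtain ⟨a, rfl⟩ := Φ.surjective s
      change Φ (ρ (GradedTensorProduct.tmul A x 1) (Φ.symm (Φ a))) =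
        cl (Ψ (GradedTensorProduct.tmul A x 1)) (Φ a)
      rw [Φ.symm_apply_apply, hΨ, Subalgebra.coe_one, mul_one]
      induction a with
      | zero => simp
      | add x y hx hy => simp only [map_add, hx, hy]
      | tmul ξ η =>
        rw [hρ 0 x 1 (SetLike.one_mem_graded (subGr Q q)), map_one]
        exact hL x ξ η
    · refine LinearMap.ext fun s => ?_
      obtain ⟨a, rfl⟩ := Φ.surjective s
      change Φ (ρ (GradedTensorProduct.tmul A 1 (subι Q q w)) (Φ.symm (Φ a))) =
        cl (Ψ (GradedTensorProduct.tmul A 1 (subι Q q w))) (Φ a)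
      rw [Φ.symm_apply_apply, hΨ, Subalgebra.coe_one, one_mul]
      induction a with
      | zero => simp
      | add x y hx hy => simp only [map_add, hx, hy]
      | tmul ξ η =>
        rw [hρ 1 1 _ (subι_mem_subGr w), map_one]
        exact hR w ξ η
  have h1 := LinearMap.congr_fun (AlgHom.congr_fun key z) (Φ a)
  change Φ (ρ z (Φ.symm (Φ a))) = _ at h1
  rw [Φ.symm_apply_apply] at h1
  exact h1

end GradedClifford

/-! ### The Clifford involution on generators, and frames of spinor modules -/

section
variable {m : ℕ} {M : Type*} [TopologicalSpace M] [ChartedSpace (EuclideanSpace ℝ (Fin m)) M]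
  [IsManifold (𝓡 m) ∞ M]

lemma clStar_ι_eq (g : Metric m M) (X : CVec m M) :
    clStar g (CliffordAlgebra.ι (Q g) X) = CliffordAlgebra.ι (Q g) (conjVec X) := by
  have hadd : ∀ x y : Cl g, clStar g (x + y) = clStar g x + clStar g y := fun x y => by
    simp only [clStar, map_add]
  induction X using TensorProduct.induction_on with
  | zero => simp [clStar]
  | add x y hx hy => rw [map_add, hadd, hx, hy, map_add, map_add]
  | tmul a v => rw [clStar_ι, conjVec_tmul]

lemma SpinorModule.exists_isFrame {g : Metric m M} {E : Type*} [AddCommGroup E]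
    [Module (CFun m M) E] (SE : SpinorModule g E) :
    ∃ (N : ℕ) (u e : Fin N → E), IsFrame SE.form u e :=
  haveI := SE.finite
  haveI := SE.projective
  SpinSub.exists_isFrame SE.form SE.form_perfect.2

end

/-! ### Horizontal and vertical spinor modules of a Riemannian submersion -/

section
variable {m : ℕ} {M : Type*} [TopologicalSpace M] [ChartedSpace (EuclideanSpace ℝ (Fin m)) M]
  [IsManifold (𝓡 m) ∞ M]
  {n : ℕ} {B : Type*} [TopologicalSpace B] [ChartedSpace (EuclideanSpace ℝ (Fin n)) B]
  [IsManifold (𝓡 n) ∞ B] [CompactSpace B] [T2Space B]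
  [Algebra (CFun n B) (CFun m M)] {π : C^∞⟮𝓡 m, M; 𝓡 n, B⟯}
  {gM : Metric m M} {gB : Metric n B} {hπ : IsPullbackAlgebra π}
  {EB : Type*} [AddCommGroup EB] [Module (CFun n B) EB]
  {EM : Type*} [AddCommGroup EM] [Module (CFun m M) EM]
  (h : IsRiemannianSubmersion gM gB hπ) (SB : SpinorModule gB EB) (SM : SpinorModule gM EM)

/-- The Clifford action of the pulled back Clifford algebra of the base on `E_H`. -/
def pullCliff : CliffordAlgebra ((Q gB).baseChange (CFun m M)) →ₐ[CFun m M]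
    Module.End (CFun m M) (HSpinor m M n B EB) :=
  CliffordAlgebra.lift _ ⟨cTilde SB, cTilde_sq SB⟩

lemma pullCliff_ι (T : CFun m M ⊗[CFun n B] CVec n B) :
    pullCliff SB (CliffordAlgebra.ι _ T) = cTilde SB T :=
  CliffordAlgebra.lift_ι_apply _ _ T

/-- Writing $S = C^\infty(M)$, the map is the composite $\mathrm{Cl}(S \otimes \mathfrak{X}(B))
\cong S \otimes \mathrm{Cl}(B) \cong S \otimes \mathrm{End}(\mathscr{E}_B) \cong \mathrm{End}(S
\otimes \mathscr{E}_B)$; the frame of $\mathscr{E}_B$ gives the last step. -/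
lemma pullCliff_bijective (hπ : IsPullbackAlgebra π) :
    Function.Bijective (pullCliff (m := m) (M := M) SB) := by
  obtain ⟨N, u, e, hf⟩ := SB.exists_isFrame
  let e₁ := CliffordAlgebra.equivBaseChange (CFun m M) (Q gB)
  let e₂ : (CFun m M ⊗[CFun n B] Cl gB) ≃ₐ[CFun m M]
      (CFun m M ⊗[CFun n B] Module.End (CFun n B) EB) :=
    Algebra.TensorProduct.congr AlgEquiv.refl SB.cliff
  have key : ∀ z, pullCliff SB z =
      LinearMap.tensorProductEnd (CFun n B) (CFun m M) EB (e₂ (e₁ z)) := by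
    have : pullCliff (m := m) (M := M) SB =
        (LinearMap.tensorProductEnd (CFun n B) (CFun m M) EB).comp
          (e₂.toAlgHom.comp e₁.toAlgHom) := by
      refine CliffordAlgebra.hom_ext (LinearMap.ext fun T => ?_)
      change pullCliff SB (CliffordAlgebra.ι _ T) = LinearMap.tensorProductEnd (CFun n B)
        (CFun m M) EB (e₂ (CliffordAlgebra.toBaseChange _ _ (CliffordAlgebra.ι _ T)))
      rw [pullCliff_ι]
      induction T with
      | zero => simp only [map_zero]
      | add x y hx hy => simp only [map_add, hx, hy]
      | tmul f Y =>
        rw [cTilde_tmul, CliffordAlgebra.toBaseChange_ι]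
        rfl
    exact fun z => AlgHom.congr_fun this z
  have := (hf.tensorProductEnd_bijective (S := CFun m M) hπ.star).comp
    (e₂.bijective.comp e₁.bijective)
  exact (funext key : ⇑(pullCliff (m := m) (M := M) SB) = _) ▸ this

/-- Horizontal lifting induces `θ` from the pulled-back Clifford algebra onto $\mathrm{Cl}_H(M)$.
Composed with `cH` it is the bijection `pullCliff`; since `θ` is surjective, `cH` is bijective. -/
theorem cH_bijective : Function.Bijective (cH h SB) := by
  let e := LinearEquiv.ofBijective _ h.bijective
  have he : ∀ T, dpi hπ (e.symm T) = T := fun T => e.apply_symm_apply T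
  let θ : CliffordAlgebra ((Q gB).baseChange (CFun m M)) →ₐ[CFun m M] ClH gM hπ :=
    CliffordAlgebra.lift _ ⟨subι (Q gM) (horizontal gM hπ) ∘ₗ e.symm.toLinearMap, fun T => by
      have h1 := h.quadratic (e.symm T).2
      rw [he] at h1
      rw [h1]
      exact Subtype.ext (CliffordAlgebra.ι_sq_scalar (Q gM) (e.symm T : CVec m M))⟩
  have hθ : ∀ T, θ (CliffordAlgebra.ι _ T) = subι (Q gM) (horizontal gM hπ) (e.symm T) :=
    fun T => CliffordAlgebra.lift_ι_apply _ _ T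
  have hcomp : ∀ z, cH h SB (θ z) = pullCliff SB z := by
    have : (cH h SB).comp θ = pullCliff SB := by
      refine CliffordAlgebra.hom_ext (LinearMap.ext fun T => ?_)
      change cH h SB (θ (CliffordAlgebra.ι _ T)) = pullCliff SB (CliffordAlgebra.ι _ T)
      rw [hθ, cH_subι, he, pullCliff_ι]
    exact fun z => AlgHom.congr_fun this z
  have hsurj : Function.Surjective θ := by
    intro x
    change x ∈ θ.range
    induction x using subCl_induction with
    | algebraMap a => exact θ.range.algebraMap_mem a
    | ι v => exact ⟨CliffordAlgebra.ι _ (e v), by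
        change θ (CliffordAlgebra.ι _ (e v)) = _
        rw [hθ, e.symm_apply_apply]⟩
    | add a b ha hb => exact add_mem ha hb
    | mul a b ha hb => exact mul_mem ha hb
  have hb := pullCliff_bijective (m := m) (M := M) SB hπ
  constructor
  · intro x y hxy
    obtain ⟨a, rfl⟩ := hsurj x
    obtain ⟨b, rfl⟩ := hsurj y
    rw [hcomp, hcomp] at hxy
    rw [hb.1 hxy]
  · intro T
    obtain ⟨z, rfl⟩ := hb.2 T
    exact ⟨θ z, hcomp z⟩

/-- Real vector fields on $B$ act by selfadjoint operators, so taking adjoints conjugates only the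
coefficients. -/
lemma cTilde_adjoint (T : CFun m M ⊗[CFun n B] CVec n B) (ξ ζ : HSpinor m M n B EB) :
    hForm hπ SB (cTilde SB T ξ) ζ = hForm hπ SB ξ (cTilde SB (conjPull hπ T) ζ) := by
  induction T with
  | zero => simp
  | add x y hx hy => simp only [map_add, LinearMap.add_apply, hx, hy]
  | tmul f Y =>
    rw [conjPull_tmul, cTilde_tmul, cTilde_tmul, LinearMap.smul_apply, LinearMap.smul_apply,
      map_smulₛₗ, LinearMap.smul_apply, map_smul]
    congr 1
    induction ξ using TensorProduct.induction_on with
    | zero => simp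
    | add x y hx hy => simp only [map_add, LinearMap.add_apply, hx, hy]
    | tmul a s =>
      induction ζ using TensorProduct.induction_on with
      | zero => simp
      | add x y hx hy => simp only [map_add, hx, hy]
      | tmul b t =>
        rw [LinearMap.baseChange_tmul, LinearMap.baseChange_tmul, hForm, formBaseChange_tmul,
          formBaseChange_tmul, SB.cliff_star, clStar_ι_eq]

/-- The actions of `Cl_H(M)` on `E_H` and `E_M` have the same adjoints. -/
lemma exists_adjoint (x : ClH gM hπ) : ∃ y : ClH gM hπ,
    (∀ ξ ζ, hForm hπ SB (cH h SB x ξ) ζ = hForm hπ SB ξ (cH h SB y ζ)) ∧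
    ∀ s t, SM.form (SM.cliff x s) t = SM.form s (SM.cliff y t) := by
  induction x using subCl_induction with
  | algebraMap a =>
    refine ⟨algebraMap _ _ (star a), fun ξ ζ => ?_, fun s t => ?_⟩
    · rw [AlgHom.commutes, AlgHom.commutes, Module.algebraMap_end_apply,
        Module.algebraMap_end_apply, map_smulₛₗ, LinearMap.smul_apply, map_smul]
      rfl
    · rw [Subalgebra.coe_algebraMap, Subalgebra.coe_algebraMap, AlgEquiv.commutes,
        AlgEquiv.commutes, Module.algebraMap_end_apply, Module.algebraMap_end_apply, map_smulₛₗ,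
        LinearMap.smul_apply, map_smul]
      rfl
  | ι X =>
    -- The conjugate field is adjoint for both actions: it stays horizontal, and $d\pi$ commutes
    -- with conjugation.
    refine ⟨subι _ _ ⟨conjVec X, conjVec_horizontal X.2⟩, fun ξ ζ => ?_, fun s t => ?_⟩
    · rw [cH_subι, cH_subι, cTilde_adjoint, ← dpi_conjVec]
    · rw [subι_coe, subι_coe, SM.cliff_star, clStar_ι_eq]
  | add a b ha hb =>
    obtain ⟨a', ha1, ha2⟩ := ha
    obtain ⟨b', hb1, hb2⟩ := hb
    refine ⟨a' + b', fun ξ ζ => ?_, fun s t => ?_⟩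
    · simp only [map_add, LinearMap.add_apply, ha1, hb1]
    · simp only [Subalgebra.coe_add, map_add, LinearMap.add_apply, ha2, hb2]
  | mul a b ha hb =>
    obtain ⟨a', ha1, ha2⟩ := ha
    obtain ⟨b', hb1, hb2⟩ := hb
    refine ⟨b' * a', fun ξ ζ => ?_, fun s t => ?_⟩
    · simp only [map_mul, Module.End.mul_apply, ha1, hb1]
    · simp only [Subalgebra.coe_mul, map_mul, Module.End.mul_apply, ha2, hb2]

/-- The Clifford action of `Cl_H(M)` on `E_M`. -/
def cliffH (hπ : IsPullbackAlgebra π) (SM : SpinorModule gM EM) :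
    ClH gM hπ →ₐ[CFun m M] Module.End (CFun m M) EM :=
  SM.cliff.toAlgHom.comp (ClH gM hπ).val

/-- The hermitian form on `E_V` and the isometry `E_H ⊗ E_V ≅ E_M`. -/
theorem exists_vForm_isometry :
    ∃ hV : SesqForm (CFun m M) (VSpinor h SB SM), IsVForm hV ∧
      (∀ η₁ η₂, star (hV η₁ η₂) = hV η₂ η₁) ∧
    ∃ Φ : HSpinor m M n B EB ⊗[CFun m M] VSpinor h SB SM ≃ₗ[CFun m M] EM,
      (∀ a b, SM.form (Φ a) (Φ b) = formTensor (hForm hπ SB) hV a b) ∧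
      ∀ ξ η, Φ (ξ ⊗ₜ η) = contract (cH_bijective h SB) (cliffH hπ SM) ξ η := by
  obtain ⟨N, u, e, hfB⟩ := SB.exists_isFrame
  -- The Morita theorem with $D = \mathscr{E}_H$, $S = \mathrm{Cl}_H(M)$ and $E = \mathscr{E}_M$;
  -- `VSpinor` unfolds to the corresponding `DualTensor`.
  exact (hfB.baseChange (S := CFun m M) hπ.star).exists_isometry (c := cliffH hπ SM)
    (formBaseChange_symm (S := CFun m M) hπ.star SB.form_symm) SM.form_symm
    (exists_adjoint h SB SM) (cH_bijective h SB)

/-- `IsVForm` constrains the form only where a preimage of $|\xi_1\rangle\langle\xi_2|$ is supplied;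
surjectivity of `cH` supplies it always, and the elements $\langle\xi| \otimes s$ span
$\mathscr{E}_V$. -/
theorem IsVForm.unique {hV hV' : SesqForm (CFun m M) (VSpinor h SB SM)} (hh : IsVForm hV)
    (hh' : IsVForm hV') : hV' = hV := by
  obtain ⟨N, u, e, hfB⟩ := SB.exists_isFrame
  refine (hfB.baseChange (S := CFun m M) hπ.star).dualForm_ext (r := cH h SB) (c := cliffH hπ SM)
    fun ξ₁ s₁ ξ₂ s₂ => ?_
  obtain ⟨x, hx⟩ := (cH_bijective h SB).2 (ketBra hπ SB ξ₁ ξ₂)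
  exact (hh' ξ₁ ξ₂ s₁ s₂ x hx).trans (hh ξ₁ ξ₂ s₁ s₂ x hx).symm

lemma contract_vGrading (ξ : HSpinor m M n B EB) (η : VSpinor h SB SM) :
    contract (cH_bijective h SB) (cliffH hπ SM) (hGrading SB ξ) (vGrading h SB SM η) =
      SM.grading (contract (cH_bijective h SB) (cliffH hπ SM) ξ η) :=
  contract_twist (c := cliffH hπ SM) (cH_bijective h SB) (hGrading_sq SB) (cH_hGrading h SB)
    (cliff_grading_comm SM) (fun _ _ => rfl) ξ η

/-- Vertical fields anticommute with horizontal ones, so $c(X)$ induces the grading automorphism on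
$\mathrm{Cl}_H(M)$, just as $\gamma_H$ does. The $\gamma_H^*$ in $c_V(X)$ is cancelled by the
$\gamma_H$ applied to $\xi$. -/
lemma contract_vGen (X : vertical hπ) (ξ : HSpinor m M n B EB) (η : VSpinor h SB SM) :
    contract (cH_bijective h SB) (cliffH hπ SM) (hGrading SB ξ) (vGen h SB SM X η) =
      SM.cliff (CliffordAlgebra.ι (Q gM) X)
        (contract (cH_bijective h SB) (cliffH hπ SM) ξ η) :=
  contract_twist (c := cliffH hπ SM) (cH_bijective h SB) (hGrading_sq SB) (cH_hGrading h SB)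
    (cliff_vert_comm SM X.2) (fun _ _ => rfl) ξ η

lemma contract_cH (x : ClH gM hπ) (ξ : HSpinor m M n B EB) (η : VSpinor h SB SM) :
    contract (cH_bijective h SB) (cliffH hπ SM) (cH h SB x ξ) η =
      SM.cliff (x : Cl gM) (contract (cH_bijective h SB) (cliffH hπ SM) ξ η) :=
  contract_apply (c := cliffH hπ SM) (cH_bijective h SB) x ξ η

end

end SpinSub
end

/-! ### The factorisation $\mathscr{E}_H \otimes \mathscr{E}_V \cong \mathscr{E}_M$ -/

set_option maxHeartbeats 1000000 in
theorem mainTheorem7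
    {m n : ℕ} (hm : Even m) (hn : Even n)
    {M : Type*} [TopologicalSpace M] [ChartedSpace (EuclideanSpace ℝ (Fin m)) M]
    [IsManifold (𝓡 m) ∞ M] [CompactSpace M] [T2Space M]
    {B : Type*} [TopologicalSpace B] [ChartedSpace (EuclideanSpace ℝ (Fin n)) B]
    [IsManifold (𝓡 n) ∞ B] [CompactSpace B] [T2Space B]
    (gM : Metric m M) (gB : Metric n B) (π : C^∞⟮𝓡 m, M; 𝓡 n, B⟯)
    [Algebra (CFun n B) (CFun m M)] (hπ : IsPullbackAlgebra π)
    (h : IsRiemannianSubmersion gM gB hπ)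
    {EB : Type*} [AddCommGroup EB] [Module (CFun n B) EB] (SB : SpinorModule gB EB)
    {EM : Type*} [AddCommGroup EM] [Module (CFun m M) EM] (SM : SpinorModule gM EM) :
    Function.Bijective (cH h SB) ∧
    ∃ hV : SesqForm (CFun m M) (VSpinor h SB SM),
      IsVForm hV ∧ (∀ hV' : SesqForm (CFun m M) (VSpinor h SB SM), IsVForm hV' → hV' = hV) ∧
      (∀ η₁ η₂, star (hV η₁ η₂) = hV η₂ η₁) ∧
    ∃ Ψ : (grH gM hπ) ᵍ⊗[CFun m M] (grV gM hπ) ≃ₐ[CFun m M] Cl gM,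
      (∀ (x : ClH gM hπ) (y : ClV gM hπ),
        Ψ (GradedTensorProduct.tmul (CFun m M) x y) = (x : Cl gM) * (y : Cl gM)) ∧
    ∃ ρ : (grH gM hπ) ᵍ⊗[CFun m M] (grV gM hπ) →ₐ[CFun m M]
        Module.End (CFun m M) (HSpinor m M n B EB ⊗[CFun m M] VSpinor h SB SM),
      (∀ (j : ZMod 2) (x : ClH gM hπ) (y : ClV gM hπ), y ∈ grV gM hπ j →
        ∀ (ξ : HSpinor m M n B EB) (η : VSpinor h SB SM),
          ρ (GradedTensorProduct.tmul (CFun m M) x y) (ξ ⊗ₜ η) =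
            cH h SB x ((hGrading SB ^ j.val) ξ) ⊗ₜ cV h SB SM y η) ∧
    ∃ Φ : HSpinor m M n B EB ⊗[CFun m M] VSpinor h SB SM ≃ₗ[CFun m M] EM,
      (∀ a b, SM.form (Φ a) (Φ b) = formTensor (hForm hπ SB) hV a b) ∧
      (∀ a, Φ (TensorProduct.map (hGrading SB) (vGrading h SB SM) a) = SM.grading (Φ a)) ∧
      (∀ z a, Φ (ρ z a) = SM.cliff (Ψ z) (Φ a)) := by
  obtain ⟨hV, hh, hsymm, Φ, hΦ, hΦc⟩ := exists_vForm_isometry h SB SM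
  obtain ⟨Ψ, hΨ⟩ := exists_gradedEquiv h.isCompl (isOrtho_hor_vert (gM := gM))
  obtain ⟨ρ, hρ⟩ := exists_gradedAction (hGrading_sq SB) (cH_hGrading h SB) (cV h SB SM)
  refine ⟨cH_bijective h SB, hV, hh, fun _ hh' => IsVForm.unique h SB SM hh hh', hsymm, Ψ, hΨ,
    ρ, hρ, Φ, hΦ, fun a => ?_, ?_⟩
  · induction a with
    | zero => simp only [map_zero]
    | add x y hx hy => simp only [map_add, hx, hy]
    | tmul ξ η => rw [TensorProduct.map_tmul, hΦc, hΦc, contract_vGrading]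
  · refine gradedAction_intertwine hΨ hρ SM.cliff.toAlgHom Φ (fun x ξ η => ?_) fun w ξ η => ?_
    · rw [hΦc, hΦc]
      exact contract_cH h SB SM x ξ η
    · rw [cV_subι, hΦc, hΦc]
      exact contract_vGen h SB SM w ξ η
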